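/- Let $\Gamma$ be a freely decomposable group, i.e. $\Gamma = H_1 * H_2$ for some nontrivial subgroups $H_1,H_2$ (no finite generation is assumed). A \emph{free factorization} $\Gamma = H_1 * \cdots * H_m$ is an internal free product decomposition with all $H_i$ nontrivial subgroups. A \emph{free factor system} of $\Gamma$ is a finite set $\mathcal A = \{[A_1],\dots,[A_K]\}$ ($K \ge 0$) of conjugacy classes of subgroups for which there is a \emph{realization} $\Gamma = A_1 * \cdots * A_K * B$ with all $A_i$ nontrivial and with cofactor $B$ free of finite rank, possibly trivial. It is \emph{proper} if $\mathcal A \neq \{[\Gamma]\}$. Let $N(\mathcal A)$ be the normal subgroup generated by all subgroups $A$ with $[A] \in \mathcal A$; then $\Gamma/N(\mathcal A) \cong B$ is free of finite rank, $\operatorname{corank}(\mathcal A)$ denotes its rank, and $$D_{FF}(\mathcal A) = 2\operatorname{corank}(\mathcal A) + |\mathcal A| - 1 .$$ Call $\mathcal A$ \emph{exceptional} if $D_{FF}(\mathcal A) \le 2$. Write $\mathcal A \sqsubset \mathcal B$ if for each $[A] \in \mathcal A$ there is $[B] \in \mathcal B$ such that $A$ is conjugate to a subgroup of $B$ (equality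 $\mathcal A = \mathcal B$ is allowed). The complex $FF(\Gamma;\mathcal A)$ is the simplicial complex whose simplices are the nonempty finite $\sqsubset$-chains of proper free factor systems $\mathcal B$ with $\mathcal A \sqsubset \mathcal B$ and $\mathcal A \ne \mathcal B$. Let $\mathcal A$ be any free factor system of $\Gamma$. Then the following hold. (0) If $D_{FF}(\mathcal A) \ge 2$, then $FF(\Gamma;\mathcal A)$ has dimension $D_{FF}(\mathcal A) - 2$, and every simplex is contained in a simplex of dimension $D_{FF}(\mathcal A)-2$. Moreover, $\mathcal A$ is exceptional if and only if $FF(\Gamma;\mathcal A)$ is empty or $0$-dimensional, and $D_{FF}(\mathcal A) = 3$ if and only if $FF(\Gamma;\mathcal A)$ is $1$-dimensional. (1) $FF(\Gamma;\mathcal A) = \emptyset \iff D_{FF}(\mathcal A) \le 1 \iff$ either $\mathcal A = \{[\Gamma]\}$, or $\mathcal A = \{[A_1],[A_2]\}$ with a free factorization $\Gamma = A_1 * A_2$. (2) $FF(\Gamma;\mathcal A)$ is $0$-dimensional $\iff D_{FF}(\mathcal A) = 2 \iff$ one of the following occurs: (a) $\mathcal A = \{[A]\}$ with a free factorization $\Gamma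 = A * Z$, where $Z$ is infinite cyclic; or (b) $\mathcal A = \{[A_1],[A_2],[A_3]\}$ with a free factorization $\Gamma = A_1 * A_2 * A_3$. (3) $FF(\Gamma;\mathcal A)$ is $1$-dimensional $\iff D_{FF}(\mathcal A) = 3 \iff$ one of the following occurs: (a) $\mathcal A = \emptyset$ with a free factorization $\Gamma = Z_1 * Z_2$, where $Z_1, Z_2$ are infinite cyclic; or (b) $\mathcal A = \{[A_1],[A_2]\}$ with a free factorization $\Gamma = A_1 * A_2 * Z$, where $Z$ is infinite cyclic; or (c) $\mathcal A = \{[A_1],[A_2],[A_3],[A_4]\}$ with a free factorization $\Gamma = A_1 * A_2 * A_3 * A_4$. Case (3)(a) occurs if and only if $\Gamma$ is free of rank $2$ and $\mathcal A$ is a Grushko free factor system of $\Gamma$, meaning that it has a realization $\Gamma = A_1 * \cdots * A_K * B$ in which no $A_i$ is freely decomposable or infinite cyclic (so $FF(\Gamma;\mathcal A)$ is then the absolute complex of free factor systems of $\Gamma$). -/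

import Mathlib

open scoped Pointwise

noncomputable section

/-- `Γ` is the internal free product of the family of subgroups `H`: the canonical homomorphism
from the abstract free product to `Γ` is an isomorphism. Trivial subgroups are allowed. -/
def IsInternalFreeProduct {Γ ι : Type*} [Group Γ] (H : ι → Subgroup Γ) : Prop :=
  Function.Bijective (Monoid.CoprodI.lift (fun i => (H i).subtype))

/-- A free factorization `Γ = * (H i)`: all terms are nontrivial. -/
def IsFreeFactorization {Γ ι : Type*} [Group Γ] (H : ι → Subgroup Γ) : Prop :=
  (∀ i, H i ≠ ⊥) ∧ IsInternalFreeProduct H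

/-- `Γ` is a free product of two nontrivial subgroups. -/
def FreelyDecomposable (Γ : Type*) [Group Γ] : Prop :=
  ∃ H₁ H₂ : Subgroup Γ, IsFreeFactorization ![H₁, H₂]

/-- The group `G` is infinite cyclic. -/
def IsInfiniteCyclic (G : Type*) [Group G] : Prop := IsCyclic G ∧ Infinite G

/-- The rank of a free group of finite rank (a meaningful value only for such groups). -/
def finiteFreeRank (G : Type*) [Group G] : ℕ := sInf {n | Nonempty (G ≃* FreeGroup (Fin n))}

/-- Conjugacy classes of subgroups of `Γ`. -/
abbrev SubgroupConjClass (Γ : Type*) [Group Γ] : Type _ :=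
  MulAction.orbitRel.Quotient (ConjAct Γ) (Subgroup Γ)

/-- The conjugacy class `[H]` of the subgroup `H`. -/
def conjClass {Γ : Type*} [Group Γ] (H : Subgroup Γ) : SubgroupConjClass Γ :=
  Quotient.mk (MulAction.orbitRel (ConjAct Γ) (Subgroup Γ)) H

/-- The relation `[A] ⊏ [A']`: `A` is conjugate to a subgroup of `A'`. -/
def SubgroupConjClass.Contained {Γ : Type*} [Group Γ] (a a' : SubgroupConjClass Γ) : Prop :=
  ∃ A A' : Subgroup Γ, conjClass A = a ∧ conjClass A' = a' ∧ A ≤ A'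

/-- `Γ = A 0 * ⋯ * A (k-1) * B` realizes the set of conjugacy classes `S = {[A 0], …, [A (k-1)]}`.
The `A i` are nontrivial, while the cofactor `B` may be trivial. -/
def IsRealization {Γ : Type*} [Group Γ] (S : Set (SubgroupConjClass Γ)) {k : ℕ}
    (A : Fin k → Subgroup Γ) (B : Subgroup Γ) : Prop :=
  S = Set.range (fun i => conjClass (A i)) ∧ (∀ i, A i ≠ ⊥) ∧
    IsInternalFreeProduct (fun o : Option (Fin k) => o.elim B A)

/-- A free factor system of `Γ`: a finite set of conjugacy classes of subgroups with a realization
whose cofactor is free of finite rank. -/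
@[ext]
structure FreeFactorSystem (Γ : Type*) [Group Γ] where
  components : Set (SubgroupConjClass Γ)
  exists_realization : ∃ (k : ℕ) (A : Fin k → Subgroup Γ) (B : Subgroup Γ),
    IsRealization components A B ∧ ∃ n : ℕ, Nonempty (B ≃* FreeGroup (Fin n))

namespace FreeFactorSystem

variable {Γ : Type*} [Group Γ]

/-- `𝒜.Extends ℬ` is the relation `𝒜 ⊏ ℬ` (`ℬ` is an extension of `𝒜`; equality is allowed). -/
def Extends (𝒜 ℬ : FreeFactorSystem Γ) : Prop :=
  ∀ a ∈ 𝒜.components, ∃ b ∈ ℬ.components, a.Contained b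

/-- `𝒜 ≠ {[Γ]}`. -/
def IsProper (𝒜 : FreeFactorSystem Γ) : Prop := 𝒜.components ≠ {conjClass ⊤}

/-- `N(𝒜)`: the subgroup normally generated by all subgroups that represent components of `𝒜`. -/
def normalSubgroup (𝒜 : FreeFactorSystem Γ) : Subgroup Γ :=
  Subgroup.normalClosure {g | ∃ H : Subgroup Γ, conjClass H ∈ 𝒜.components ∧ g ∈ H}

instance (𝒜 : FreeFactorSystem Γ) : 𝒜.normalSubgroup.Normal := Subgroup.normalClosure_normal

/-- The corank of `𝒜`: the rank of the free group `Γ / N(𝒜)`. -/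
def corank (𝒜 : FreeFactorSystem Γ) : ℕ := finiteFreeRank (Γ ⧸ 𝒜.normalSubgroup)

/-- The corank is the rank of the cofactor of any realization. -/
theorem corank_eq (𝒜 : FreeFactorSystem Γ) {k n : ℕ} {A : Fin k → Subgroup Γ} {B : Subgroup Γ}
    (h : IsRealization 𝒜.components A B) (e : B ≃* FreeGroup (Fin n)) : 𝒜.corank = n := by
  obtain ⟨hS, -, hbij⟩ := h
  let F : Option (Fin k) → Subgroup Γ := fun o => o.elim B A
  let φ : Monoid.CoprodI (fun o => (F o : Type _)) ≃* Γ := MulEquiv.ofBijective _ hbij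
  have hφ : ∀ (o : Option (Fin k)) (x : F o),
      φ.symm (x : Γ) = Monoid.CoprodI.of (M := fun o => (F o : Type _)) x := by
    intro o x
    rw [MulEquiv.symm_apply_eq]
    exact (Monoid.CoprodI.lift_of (M := fun o => (F o : Type _)) (fun o => (F o).subtype) x).symm
  let r : ∀ o, F o →* B := fun o => match o with
    | none => MonoidHom.id B
    | some _ => 1
  let ρ : Γ →* B := (Monoid.CoprodI.lift r).comp φ.symm.toMonoidHom
  have hρA : ∀ (i : Fin k) (a : Γ), a ∈ A i → ρ a = 1 := by
    intro i a ha
    change Monoid.CoprodI.lift r (φ.symm a) = 1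
    rw [show φ.symm a = _ from hφ (some i) ⟨a, ha⟩, Monoid.CoprodI.lift_of]
    rfl
  have hρB : ∀ b : B, ρ (b : Γ) = b := by
    intro b
    change Monoid.CoprodI.lift r (φ.symm (b : Γ)) = b
    rw [show φ.symm (b : Γ) = _ from hφ none b]
    exact Monoid.CoprodI.lift_of r (i := none) b
  have hker : ρ.ker = 𝒜.normalSubgroup := by
    apply le_antisymm
    · let m : Γ →* Γ ⧸ 𝒜.normalSubgroup := QuotientGroup.mk' _
      have key : m.comp φ.toMonoidHom = (m.comp (B.subtype.comp ρ)).comp φ.toMonoidHom := by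
        apply Monoid.CoprodI.ext_hom
        intro o
        ext x
        have hx : φ (Monoid.CoprodI.of x) = (x : Γ) := by
          rw [← hφ o x, MulEquiv.apply_symm_apply]
        change m (φ (Monoid.CoprodI.of x)) = m (ρ (φ (Monoid.CoprodI.of x)) : Γ)
        rw [hx]
        match o, x with
        | none, x => rw [hρB x]
        | some i, x =>
          rw [hρA i x x.2, OneMemClass.coe_one, map_one]
          refine (QuotientGroup.eq_one_iff _).2 (Subgroup.subset_normalClosure ?_)
          exact ⟨A i, by rw [hS]; exact ⟨i, rfl⟩, x.2⟩
      intro g hg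
      have h1 := DFunLike.congr_fun key (φ.symm g)
      have h2 : m (φ (φ.symm g)) = m (ρ (φ (φ.symm g)) : Γ) := h1
      rw [MulEquiv.apply_symm_apply, MonoidHom.mem_ker.1 hg, OneMemClass.coe_one, map_one] at h2
      exact (QuotientGroup.eq_one_iff _).1 h2
    · refine Subgroup.normalClosure_le_normal ?_
      rintro g ⟨H, hH, hg⟩
      rw [hS] at hH
      obtain ⟨i, hi⟩ := hH
      obtain ⟨c, hc⟩ := Quotient.exact hi
      have hgc : ConjAct.ofConjAct c * g * (ConjAct.ofConjAct c)⁻¹ ∈ A i := by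
        rw [← hc]
        exact Subgroup.smul_mem_pointwise_smul g c H hg
      have h1 := hρA i _ hgc
      rw [map_mul, map_mul, map_inv] at h1
      have h2 : ρ g = 1 := conj_eq_one_iff.1 h1
      exact h2
  have hsurj : Function.Surjective ρ := fun b => ⟨b, hρB b⟩
  let q : Γ ⧸ 𝒜.normalSubgroup ≃* FreeGroup (Fin n) :=
    ((QuotientGroup.quotientMulEquivOfEq hker.symm).trans
      (QuotientGroup.quotientKerEquivOfSurjective ρ hsurj)).trans e
  have hset : {j | Nonempty ((Γ ⧸ 𝒜.normalSubgroup) ≃* FreeGroup (Fin j))} = {n} := by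
    ext j
    constructor
    · rintro ⟨f⟩
      exact Fin.equiv_iff_eq.1 ⟨Equiv.ofFreeGroupEquiv (f.symm.trans q)⟩
    · rintro rfl
      exact ⟨q⟩
  change sInf _ = n
  rw [hset, csInf_singleton]

/-- The free factor system depth `2 corank(𝒜) + |𝒜| - 1`, an integer. -/
def depth (𝒜 : FreeFactorSystem Γ) : ℤ := 2 * (𝒜.corank : ℤ) + (𝒜.components.ncard : ℤ) - 1

/-- Exceptional free factor systems: those of depth at most `2`. -/
def IsExceptional (𝒜 : FreeFactorSystem Γ) : Prop := 𝒜.depth ≤ 2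

/-- `𝒜` is a Grushko free factor system: it has a realization whose terms other than the (free)
cofactor are freely indecomposable and not infinite cyclic. -/
def IsGrushko (𝒜 : FreeFactorSystem Γ) : Prop :=
  ∃ (k : ℕ) (A : Fin k → Subgroup Γ) (B : Subgroup Γ),
    IsRealization 𝒜.components A B ∧ (∃ n : ℕ, Nonempty (B ≃* FreeGroup (Fin n))) ∧
      ∀ i, ¬ FreelyDecomposable (A i) ∧ ¬ IsInfiniteCyclic (A i)

/-- The complex `FF(Γ;𝒜)` of free factor systems of `Γ` relative to `𝒜`, as an abstract simplicial
complex: its simplices are the nonempty finite `⊏`-chains of proper free factor systems that are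
proper extensions of `𝒜`. Its vertices are the `ℬ` for which `{ℬ}` is a simplex. -/
def relComplex (𝒜 : FreeFactorSystem Γ) : PreAbstractSimplicialComplex (FreeFactorSystem Γ) where
  faces := {s | s.Nonempty ∧ IsChain Extends (s : Set (FreeFactorSystem Γ)) ∧
    ∀ ℬ ∈ s, 𝒜.Extends ℬ ∧ 𝒜 ≠ ℬ ∧ ℬ.IsProper}
  isRelLowerSet_faces := fun _ hs => ⟨hs.1, fun _ hts ht =>
    ⟨ht, hs.2.1.mono (Finset.coe_subset.2 hts), fun ℬ hℬ => hs.2.2 ℬ (hts hℬ)⟩⟩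

end FreeFactorSystem

/-- The dimension of an abstract simplicial complex: the supremum of the dimensions `#s - 1` of its
simplices `s`; it is `⊥` for the empty complex and `⊤` if these dimensions are unbounded. -/
def simplicialDim {V : Type*} (K : PreAbstractSimplicialComplex V) : WithBot ℕ∞ :=
  ⨆ s : K.faces, (((s.1.card - 1 : ℕ) : ℕ∞) : WithBot ℕ∞)

end

/-!
The depth of a free factor system `𝒜` with a realization `Γ = A₁ * ⋯ * A_k * B`, where `B` is free
of rank `n`, is `2 n + k - 1`. Everything follows from one fact (`FreeFactorSystem.exists_step`): if
`𝒜 ⊏ ℬ` and `𝒜 ≠ ℬ`, then there is a system between them whose depth is that of `𝒜` minus one. As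
depth is bounded below, such steps reach `ℬ` after finitely many repetitions, so depth is strictly
decreasing along `⊏`, and every depth between those of `ℬ` and `𝒜` is attained between them. The
system `{[Γ]}` is the greatest one and has depth `0`. Hence the members of a simplex relative to `𝒜`
have distinct depths strictly between `0` and the depth of `𝒜`, and a chain that misses one of these
values can be enlarged, which gives the dimension and the purity of the complex. The lists of
decompositions of small depth are the solutions of `2 n + k - 1 ≤ 1`, `= 2` and `= 3`. Those that
make `Γ` trivial or infinite cyclic are excluded by free decomposability of `Γ`. In a free group of
rank two, the components of a Grushko system are free by the Nielsen–Schreier theorem, so that there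
are none.

For the step, split the cofactor of `𝒜` into infinite cyclic groups `Z l` (`IsFineRealization`). By
the Kurosh subgroup theorem, the factors of a realization of `ℬ` are free products of conjugates of
subgroups of the `A i` and the `Z l`, and of infinite cyclic groups. Free factors are malnormal, so
each `A i` contributes a single nontrivial factor, which is a full conjugate of `A i`. This yields a
realization of `𝒜` each of whose terms lies in a term of that of `ℬ`
(`IsFineRealization.exists_compatible`). If a component of `ℬ` contains a cyclic term, make this
term a component of `𝒜`; if it contains two components of `𝒜`, merge them; otherwise `𝒜 = ℬ`.

The Kurosh theorem (`TransversalSystem.kurosh`) is proved with cocycles `Γ × X → K` for the action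
of `Γ` on a coset space `X`. Such a cocycle is an action of `Γ` on `X × K` over `X` that commutes
with right multiplication, so by the universal property of the free product it can be prescribed
freely on the factors (`IsInternalFreeProduct.exists_cocycle`). If `K` is the free product that is
to be identified with the point stabilizer, the evident choice gives the inverse isomorphism.
Cocycles also show malnormality (`IsInternalFreeProduct.malnormal`).
-/

/-! ### Internal free products, cocycles, and malnormality -/

namespace IsInternalFreeProduct

variable {Γ ι : Type*} [Group Γ] {F : ι → Subgroup Γ}

theorem iSup_eq_top (h : IsInternalFreeProduct F) : ⨆ i, F i = ⊤ := by
  have := Monoid.CoprodI.range_eq_iSup (G := fun i => F i) (fun i => (F i).subtype)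
  simp only [Subgroup.range_subtype] at this
  rw [← this, MonoidHom.range_eq_top]
  exact h.2

/-- Induction over products of elements of the factors. -/
theorem induction (h : IsInternalFreeProduct F) {p : Γ → Prop} (one : p 1)
    (mem : ∀ i, ∀ g ∈ F i, p g) (mul : ∀ g g', p g → p g' → p (g * g')) (g : Γ) : p g :=
  Subgroup.iSup_induction F (C := p) (by rw [h.iSup_eq_top]; trivial) mem one mul

/-- The universal property of a free product, for families of homomorphisms given as functions
on all of `Γ` that are multiplicative on the factors. -/
theorem exists_hom (h : IsInternalFreeProduct F) {K : Type*} [Monoid K] (ψ : ι → Γ → K)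
    (h1 : ∀ i, ψ i 1 = 1) (hm : ∀ i, ∀ x ∈ F i, ∀ y ∈ F i, ψ i (x * y) = ψ i x * ψ i y) :
    ∃ Φ : Γ →* K, ∀ i, ∀ x ∈ F i, Φ x = ψ i x := by
  let φ : Monoid.CoprodI (fun i => F i) ≃* Γ := MulEquiv.ofBijective _ h
  let f : ∀ i, F i →* K := fun i =>
    { toFun := fun x => ψ i x
      map_one' := h1 i
      map_mul' := fun x y => hm i x x.2 y y.2 }
  refine ⟨(Monoid.CoprodI.lift f).comp φ.symm.toMonoidHom, fun i x hx => ?_⟩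
  have : φ.symm x = Monoid.CoprodI.of (M := fun i => F i) ⟨x, hx⟩ := by
    rw [MulEquiv.symm_apply_eq]
    exact (Monoid.CoprodI.lift_of (M := fun i => F i) (fun i => (F i).subtype) ⟨x, hx⟩).symm
  change Monoid.CoprodI.lift f (φ.symm x) = _
  rw [this, Monoid.CoprodI.lift_of]
  rfl

theorem exists_hom_group (h : IsInternalFreeProduct F) {K : Type*} [Group K] (ψ : ι → Γ → K)
    (hm : ∀ i, ∀ x ∈ F i, ∀ y ∈ F i, ψ i (x * y) = ψ i x * ψ i y) :
    ∃ Φ : Γ →* K, ∀ i, ∀ x ∈ F i, Φ x = ψ i x :=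
  h.exists_hom ψ (fun i => by simpa using hm i 1 (one_mem _) 1 (one_mem _)) hm

theorem hom_ext (h : IsInternalFreeProduct F) {K : Type*} [Monoid K] {Φ Ψ : Γ →* K}
    (H : ∀ i, ∀ x ∈ F i, Φ x = Ψ x) : Φ = Ψ := by
  ext g
  induction g using h.induction with
  | one => simp
  | mem i g hg => exact H i g hg
  | mul g g' h1 h2 => simp [h1, h2]

end IsInternalFreeProduct

section CoprodI

variable {Γ ι : Type*} [Group Γ]

open Classical in
/-- The canonical map from the subgroup `F i` to the abstract free product, extended by `1` to
all of `Γ`. -/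
noncomputable def coprodOf (F : ι → Subgroup Γ) (i : ι) (x : Γ) :
    Monoid.CoprodI (fun i => F i) :=
  if h : x ∈ F i then Monoid.CoprodI.of (M := fun i => F i) ⟨x, h⟩ else 1

variable {F : ι → Subgroup Γ}

theorem coprodOf_of_mem {i : ι} {x : Γ} (h : x ∈ F i) :
    coprodOf F i x = Monoid.CoprodI.of (M := fun i => F i) ⟨x, h⟩ := dif_pos h

theorem coprodOf_mul {i : ι} {x y : Γ} (hx : x ∈ F i) (hy : y ∈ F i) :
    coprodOf F i (x * y) = coprodOf F i x * coprodOf F i y := by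
  rw [coprodOf_of_mem hx, coprodOf_of_mem hy, coprodOf_of_mem (mul_mem hx hy), ← map_mul]
  rfl

theorem coprodOf_one (i : ι) : coprodOf F i 1 = 1 := by
  rw [coprodOf_of_mem (one_mem _)]
  exact map_one _

theorem lift_coprodOf {i : ι} {x : Γ} (hx : x ∈ F i) :
    Monoid.CoprodI.lift (fun i => (F i).subtype) (coprodOf F i x) = x := by
  rw [coprodOf_of_mem hx, Monoid.CoprodI.lift_of]
  rfl

/-- A generating family of subgroups is a free product decomposition as soon as the canonical maps
to the abstract free product extend to a homomorphism on `Γ`. -/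
theorem IsInternalFreeProduct.of_retraction (htop : ⨆ i, F i = ⊤)
    (φ : Γ →* Monoid.CoprodI (fun i => F i)) (hφ : ∀ i, ∀ x ∈ F i, φ x = coprodOf F i x) :
    IsInternalFreeProduct F := by
  constructor
  · refine Function.LeftInverse.injective (g := φ) fun w => ?_
    have : φ.comp (Monoid.CoprodI.lift (fun i => (F i).subtype)) = MonoidHom.id _ := by
      refine Monoid.CoprodI.ext_hom _ _ fun i => ?_
      ext x
      simp only [MonoidHom.comp_apply, Monoid.CoprodI.lift_of, MonoidHom.id_apply]
      exact (hφ i x x.2).trans (coprodOf_of_mem x.2)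
    exact DFunLike.congr_fun this w
  · rw [← MonoidHom.range_eq_top, Monoid.CoprodI.range_eq_iSup]
    simpa using htop

end CoprodI

namespace IsInternalFreeProduct

variable {Γ ι κ : Type*} [Group Γ] {F : ι → Subgroup Γ}

/-- Reindexing a free product along an injection whose range misses only trivial factors. -/
theorem reindex (h : IsInternalFreeProduct F) (f : κ → ι) (hf : Function.Injective f)
    (htriv : ∀ i, i ∉ Set.range f → F i = ⊥) : IsInternalFreeProduct (fun k => F (f k)) := by
  classical
  let F' : κ → Subgroup Γ := fun k => F (f k)
  obtain ⟨Φ, hΦ⟩ := h.exists_hom_group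
    (fun i x => if hi : ∃ k, f k = i then coprodOf F' hi.choose x else 1) (by
      intro i x hx y hy
      by_cases hi : ∃ k, f k = i
      · have := hi.choose_spec
        simp only [dif_pos hi]
        exact coprodOf_mul (by rwa [← this] at hx) (by rwa [← this] at hy)
      · simp [dif_neg hi])
  refine of_retraction ?_ Φ fun k x hx => ?_
  · rw [eq_top_iff, ← h.iSup_eq_top]
    refine iSup_le fun i => ?_
    by_cases hi : i ∈ Set.range f
    · obtain ⟨k, rfl⟩ := hi
      exact le_iSup (fun k => F (f k)) k
    · rw [htriv i hi]
      exact bot_le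
  · have hi : ∃ k', f k' = f k := ⟨k, rfl⟩
    rw [hΦ _ x hx, dif_pos hi, hf hi.choose_spec]

/-- Merging the factors of a free product along a map of index sets. -/
theorem merge (h : IsInternalFreeProduct F) (π : ι → κ) :
    IsInternalFreeProduct (fun k => ⨆ i : {i // π i = k}, F i) := by
  let M : κ → Subgroup Γ := fun k => ⨆ i : {i // π i = k}, F i
  have hle : ∀ i, F i ≤ M (π i) := fun i =>
    le_iSup (fun j : {j // π j = π i} => F j) ⟨i, rfl⟩
  obtain ⟨Φ, hΦ⟩ := h.exists_hom_group (fun i x => coprodOf M (π i) x)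
    (fun i x hx y hy => coprodOf_mul (hle i hx) (hle i hy))
  refine of_retraction ?_ Φ fun k x hx => ?_
  · rw [eq_top_iff, ← h.iSup_eq_top]
    exact iSup_le fun i => (hle i).trans (le_iSup M (π i))
  · have hx' : x ∈ M k ∧ Φ x = coprodOf M k x := by
      refine Subgroup.iSup_induction (fun i : {i // π i = k} => F i)
        (C := fun x => x ∈ M k ∧ Φ x = coprodOf M k x) hx ?_ ?_ ?_
      · rintro ⟨i, rfl⟩ y hy
        exact ⟨hle i hy, hΦ i y hy⟩
      · exact ⟨one_mem _, by rw [map_one, coprodOf_one]⟩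
      · rintro y z ⟨hy, hy'⟩ ⟨hz, hz'⟩
        exact ⟨mul_mem hy hz, by rw [map_mul, hy', hz', coprodOf_mul hy hz]⟩
    exact hx'.2

/-- If `Γ` is the free product of the subgroups `H o`, and these decompose compatibly into the
members of a generating family `F`, then `Γ` is the free product of that family. -/
theorem refine {H : κ → Subgroup Γ} (h : IsInternalFreeProduct H) (htop : ⨆ i, F i = ⊤)
    (ψ : κ → Γ → Monoid.CoprodI (fun i => F i))
    (hψ : ∀ k, ∀ x ∈ H k, ∀ y ∈ H k, ψ k (x * y) = ψ k x * ψ k y)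
    (π : ι → κ) (hπ : ∀ i, F i ≤ H (π i)) (hof : ∀ i, ∀ x ∈ F i, ψ (π i) x = coprodOf F i x) :
    IsInternalFreeProduct F := by
  obtain ⟨Φ, hΦ⟩ := h.exists_hom_group ψ hψ
  exact of_retraction htop Φ fun i x hx => (hΦ (π i) x (hπ i hx)).trans (hof i x hx)

/-- Cocycles `F i × X → K` on the factors of a free product extend to a cocycle `Γ × X → K`:
a cocycle is the same as an action on `X × K` lifting the one on `X` and commuting with right
multiplication. -/
theorem exists_cocycle (h : IsInternalFreeProduct F) {X K : Type*} [MulAction Γ X] [Group K]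
    (c : ι → Γ → X → K)
    (hc : ∀ i, ∀ g ∈ F i, ∀ g' ∈ F i, ∀ x, c i (g * g') x = c i g (g' • x) * c i g' x) :
    ∃ C : Γ → X → K, (∀ g g' x, C (g * g') x = C g (g' • x) * C g' x) ∧
      ∀ i, ∀ g ∈ F i, ∀ x, C g x = c i g x := by
  have hc1 : ∀ i x, c i 1 x = 1 := fun i x => by
    simpa using hc i 1 (one_mem _) 1 (one_mem _) x
  obtain ⟨Φ, hΦ⟩ := h.exists_hom (K := Function.End (X × K))
    (fun i g p => (g • p.1, c i g p.1 * p.2))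
    (fun i => by funext p; simp [hc1]; rfl)
    (fun i g hg g' hg' => by
      funext p
      change _ = (g • g' • p.1, c i g (g' • p.1) * (c i g' p.1 * p.2))
      simp [hc i g hg g' hg', mul_smul, mul_assoc])
  have key : ∀ g x k, Φ g (x, k) = (g • x, (Φ g (x, 1)).2 * k) := by
    intro g
    induction g using h.induction with
    | one =>
      intro x k
      rw [map_one, one_smul]
      exact Prod.ext rfl (one_mul k).symm
    | mem i g hg => intro x k; simp [hΦ i g hg]
    | mul g g' h1 h2 =>
      intro x k
      simp only [map_mul]
      change Φ g (Φ g' (x, k)) = (_, (Φ g (Φ g' (x, 1))).2 * k)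
      rw [h2, h1, h2 x 1, h1 _ ((Φ g' (x, 1)).2 * 1)]
      simp [mul_smul, mul_assoc]
  refine ⟨fun g x => (Φ g (x, 1)).2, fun g g' x => ?_, fun i g hg x => ?_⟩
  · have h1 : (Φ (g * g') (x, 1)).2 = (Φ g (Φ g' (x, 1))).2 := by rw [map_mul]; rfl
    refine h1.trans ?_
    rw [key g' x 1, key g (g' • x) _, mul_one]
  · simp [hΦ i g hg]

/-- Projection to a factor of a free product. -/
theorem exists_projection (h : IsInternalFreeProduct F) (i : ι) :
    ∃ ρ : Γ →* Γ, (∀ x ∈ F i, ρ x = x) ∧ ∀ j, j ≠ i → ∀ x ∈ F j, ρ x = 1 := by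
  classical
  obtain ⟨ρ, hρ⟩ := h.exists_hom_group (fun j x => if j = i then x else 1)
    (by intro j x _ y _; split_ifs <;> simp)
  exact ⟨ρ, fun x hx => by simpa using hρ i x hx, fun j hj x hx => by simpa [hj] using hρ j x hx⟩

/-- The factors of a free product are malnormal: a nontrivial element of one factor can be
conjugate to an element of another factor only if these factors and their cosets agree.
For a single factor `F i`, let `Γ` act on `Γ ⧸ F i` and extend the cocycle with values in `Γ` that
is the identity of `F i` over the base point and trivial elsewhere. -/
theorem malnormal (h : IsInternalFreeProduct F) {i j : ι} {x g : Γ} (hx : x ∈ F i) (hx1 : x ≠ 1)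
    (hxg : g * x * g⁻¹ ∈ F j) : i = j ∧ g ∈ F i := by
  have hij : i = j := by
    by_contra hij
    obtain ⟨ρ, -, hρ⟩ := h.exists_projection j
    obtain ⟨ρ', hρ', hρ''⟩ := h.exists_projection i
    have h1 := hρ'' j (Ne.symm hij) _ hxg
    rw [map_mul, map_mul, map_inv, conj_eq_one_iff, hρ' x hx] at h1
    exact hx1 h1
  subst hij
  refine ⟨rfl, ?_⟩
  by_contra hg
  classical
  let x₀ : Γ ⧸ F i := ((1 : Γ) : Γ ⧸ F i)
  have hfix : ∀ a : Γ, a • x₀ = x₀ ↔ a ∈ F i := fun a => by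
    simp [x₀, QuotientGroup.eq, MulAction.Quotient.smul_mk]
  obtain ⟨C, hC, hCc⟩ := h.exists_cocycle (X := Γ ⧸ F i) (K := Γ)
    (fun k a p => if k = i ∧ p = x₀ then a else 1) (by
      intro k a ha b hb p
      by_cases hk : k = i
      · subst hk
        have : b • p = x₀ ↔ p = x₀ := by
          rw [← (hfix _).2 hb, smul_left_cancel_iff, (hfix _).2 hb]
        simp only [this, true_and]
        split_ifs <;> simp
      · simp [hk])
  -- compare the two ways to write `g * x = (g * x * g⁻¹) * g` at the point `g⁻¹ • x₀`
  have e1 : C (g * x * g⁻¹ * g) x₀ = C (g * x) x₀ := by rw [inv_mul_cancel_right]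
  rw [hC (g * x * g⁻¹) g, hC g x, hCc i x hx, (hfix x).2 hx] at e1
  have hgx : g • x₀ ≠ x₀ := fun h0 => hg ((hfix _).1 h0)
  rw [hCc i _ hxg, if_neg (by tauto), if_pos ⟨rfl, rfl⟩, one_mul] at e1
  exact hx1 (by simpa using e1)

end IsInternalFreeProduct

/-! ### The Kurosh subgroup theorem -/

/-- An element with a left inverse of `n ↦ z ^ n` generates an infinite cyclic subgroup. -/
theorem isInfiniteCyclic_zpowers {Γ : Type*} [Group Γ] {z : Γ} (log : Γ → ℤ)
    (hlog : ∀ n : ℤ, log (z ^ n) = n) : IsInfiniteCyclic (Subgroup.zpowers z) := by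
  refine ⟨inferInstance, ?_⟩
  have hinj : Function.Injective (fun n : ℤ => (⟨z ^ n, n, rfl⟩ : Subgroup.zpowers z)) := by
    intro m n hmn
    have : z ^ m = z ^ n := congrArg Subtype.val hmn
    rw [← hlog m, this, hlog n]
  exact Infinite.of_injective _ hinj

/-- Recursion along a length function on a pointed set. -/
theorem exists_recursive_of_lt {X M : Type*} [Mul M] [One M] (x₀ : X) (len : X → ℕ)
    (par : X → X) (v : X → M) (hlt : ∀ x, x ≠ x₀ → len (par x) < len x) :
    ∃ τ : X → M, τ x₀ = 1 ∧ ∀ x, x ≠ x₀ → τ x = v x * τ (par x) := by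
  classical
  let step : ∀ x, (∀ y, len y < len x → M) → M := fun x ih =>
    if hx : x = x₀ then 1 else v x * ih (par x) (hlt x hx)
  have wf : WellFounded (fun y x => len y < len x) := (measure len).wf
  refine ⟨wf.fix step, ?_, fun x hx => ?_⟩
  · rw [wf.fix_eq]
    exact dif_pos rfl
  · rw [wf.fix_eq]
    exact dif_neg hx

/-- A system of transversals for a family of subgroups `G i` of a group `Γ` acting transitively on
a pointed set `X`. Each `G i`-orbit has a representative `r i x`, from which `u i x ∈ G i` leads
to `x`. The edges from `r i x` to `x`, labelled `i`, form a connected graph on `X`; the elements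
`τ x` carry the base point to `x` along a spanning tree of it, in which a vertex `x ≠ x₀` is joined
to the vertex `r i x`, of smaller length `len`, for some `i`. -/
structure TransversalSystem {Γ ι X : Type*} [Group Γ] [MulAction Γ X] (G : ι → Subgroup Γ)
    (x₀ : X) where
  r : ι → X → X
  u : ι → X → Γ
  τ : X → Γ
  len : X → ℕ
  u_mem : ∀ i x, u i x ∈ G i
  u_smul : ∀ i x, u i x • r i x = x
  u_eq_one : ∀ i x, r i x = x → u i x = 1
  r_smul : ∀ i, ∀ g ∈ G i, ∀ x, r i (g • x) = r i x
  τ_base : τ x₀ = 1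
  τ_rec : ∀ x, x ≠ x₀ → ∃ i, len (r i x) < len x ∧ τ x = u i x * τ (r i x)

/-- The length of `x`: the least number of elements of the factors whose product carries `x₀` to
`x`. -/
theorem IsInternalFreeProduct.exists_len {Γ ι X : Type*} [Group Γ] [MulAction Γ X]
    [MulAction.IsPretransitive Γ X] {G : ι → Subgroup Γ} (h : IsInternalFreeProduct G) (x₀ : X) :
    ∃ len : X → ℕ, ∀ x, x ≠ x₀ → ∃ i, ∃ g ∈ G i, len (g • x) < len x := by
  classical
  have hword : ∀ g : Γ, ∃ l : List Γ, (∀ a ∈ l, ∃ i, a ∈ G i) ∧ l.prod = g := by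
    intro g
    induction g using h.induction with
    | one => exact ⟨[], by simp⟩
    | mem i g hg => exact ⟨[g], by simpa using ⟨i, hg⟩, by simp⟩
    | mul g g' h1 h2 =>
      obtain ⟨l, hl, rfl⟩ := h1
      obtain ⟨l', hl', rfl⟩ := h2
      exact ⟨l ++ l', fun a ha => (List.mem_append.1 ha).elim (hl a) (hl' a), by simp⟩
  have hex : ∀ x : X, ∃ n : ℕ, ∃ l : List Γ,
      l.length = n ∧ (∀ a ∈ l, ∃ i, a ∈ G i) ∧ l.prod • x₀ = x := by
    intro x
    obtain ⟨g, rfl⟩ := MulAction.exists_smul_eq Γ x₀ x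
    obtain ⟨l, hl, rfl⟩ := hword g
    exact ⟨_, l, rfl, hl, rfl⟩
  refine ⟨fun x => Nat.find (hex x), fun x hx => ?_⟩
  obtain ⟨l, hl, hmem, hlx⟩ := Nat.find_spec (hex x)
  cases l with
  | nil => exact absurd (by simpa using hlx.symm) hx
  | cons a l =>
    obtain ⟨i, hi⟩ := hmem a (by simp)
    refine ⟨i, a⁻¹, inv_mem hi, ?_⟩
    have : Nat.find (hex (a⁻¹ • x)) ≤ l.length :=
      Nat.find_min' _ ⟨l, rfl, fun b hb => hmem b (by simp [hb]), by
        rw [← hlx, List.prod_cons, mul_smul, inv_smul_smul]⟩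
    rw [List.length_cons] at hl
    exact this.trans_lt ((Nat.lt_succ_self _).trans_eq hl)

/-- As orbit representatives one takes points of minimal length, so that every point `x ≠ x₀` lies
in the orbit of a shorter representative for one of the factors. -/
theorem IsInternalFreeProduct.exists_transversalSystem {Γ ι X : Type*} [Group Γ] [MulAction Γ X]
    [MulAction.IsPretransitive Γ X] {G : ι → Subgroup Γ} (h : IsInternalFreeProduct G) (x₀ : X) :
    Nonempty (TransversalSystem G x₀) := by
  classical
  obtain ⟨len, hlen⟩ := h.exists_len x₀
  have hmin : ∀ S : Set X, ∃ y, S.Nonempty → y ∈ S ∧ ∀ z ∈ S, len y ≤ len z := by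
    intro S
    by_cases hS : S.Nonempty
    · exact ⟨Function.argminOn len S hS, fun _ =>
        ⟨Function.argminOn_mem _ _ _, fun z hz => Function.argminOn_le _ _ hz⟩⟩
    · exact ⟨x₀, fun h => absurd h hS⟩
  choose m hm using hmin
  let S : ι → X → Set X := fun i x => {y | ∃ g ∈ G i, g • x = y}
  have hS : ∀ i x, x ∈ S i x := fun i x => ⟨1, one_mem _, one_smul _ _⟩
  have hu : ∀ i x, ∃ u : Γ, u ∈ G i ∧ u • m (S i x) = x ∧ (m (S i x) = x → u = 1) := by
    intro i x
    by_cases hx : m (S i x) = x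
    · exact ⟨1, one_mem _, by rw [one_smul, hx], fun _ => rfl⟩
    · obtain ⟨g, hg, hgx⟩ := (hm (S i x) ⟨x, hS i x⟩).1
      exact ⟨g⁻¹, inv_mem hg, by rw [← hgx, inv_smul_smul], fun h => absurd h hx⟩
  choose u hu1 hu2 hu3 using hu
  have hpar : ∀ x, ∃ y : X, ∃ v : Γ,
      x ≠ x₀ → ∃ i, y = m (S i x) ∧ v = u i x ∧ len y < len x := by
    intro x
    by_cases hx : x = x₀
    · exact ⟨x, 1, fun h => absurd hx h⟩
    · obtain ⟨i, g, hg, hlt⟩ := hlen x hx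
      exact ⟨m (S i x), u i x, fun _ => ⟨i, rfl, rfl,
        ((hm (S i x) ⟨x, hS i x⟩).2 _ ⟨g, hg, rfl⟩).trans_lt hlt⟩⟩
  choose par v hpar using hpar
  obtain ⟨τ, hτ0, hτ⟩ := exists_recursive_of_lt x₀ len par v fun x hx => by
    obtain ⟨i, -, -, h⟩ := hpar x hx
    exact h
  refine ⟨⟨fun i x => m (S i x), u, τ, len, hu1, hu2, hu3, fun i g hg x => ?_, hτ0,
    fun x hx => ?_⟩⟩
  · congr 1
    ext y
    constructor
    · rintro ⟨a, ha, rfl⟩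
      exact ⟨a * g, mul_mem ha hg, mul_smul _ _ _⟩
    · rintro ⟨a, ha, rfl⟩
      exact ⟨a * g⁻¹, mul_mem ha (inv_mem hg), by rw [mul_smul, inv_smul_smul]⟩
  · obtain ⟨i, h1, h2, h3⟩ := hpar x hx
    exact ⟨i, h1 ▸ h3, by rw [hτ x hx, h1, h2]⟩

namespace TransversalSystem

variable {Γ ι X : Type*} [Group Γ] [MulAction Γ X] {G : ι → Subgroup Γ} {x₀ : X}
  (D : TransversalSystem G x₀)

theorem r_r (i : ι) (x : X) : D.r i (D.r i x) = D.r i x := by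
  conv_rhs => rw [← D.u_smul i x, D.r_smul i _ (D.u_mem i x)]

/-- Induction along the spanning tree. -/
theorem tree_induction {p : X → Prop} (base : p x₀)
    (step : ∀ x i, D.τ x = D.u i x * D.τ (D.r i x) → p (D.r i x) → p x) (x : X) : p x := by
  induction hn : D.len x using Nat.strong_induction_on generalizing x with
  | _ n ih =>
    by_cases hx : x = x₀
    · rwa [hx]
    · obtain ⟨i, hlt, hτ⟩ := D.τ_rec x hx
      exact step x i hτ (ih _ (hn ▸ hlt) _ rfl)

theorem τ_smul (x : X) : D.τ x • x₀ = x := by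
  refine D.tree_induction (p := fun x => D.τ x • x₀ = x) ?_ (fun x i h ih => ?_) x
  · rw [D.τ_base, one_smul]
  · rw [h, mul_smul, ih, D.u_smul]

/-- The loop based at `x₀` that runs through the edge from `r i x` to `x`. It is trivial for the
edges of the spanning tree and for the degenerate edges with `r i x = x`. -/
def t (i : ι) (x : X) : Γ := (D.τ x)⁻¹ * D.u i x * D.τ (D.r i x)

/-- The stabilizer of `x` in `G i`, conjugated into the stabilizer of the base point. -/
def vert (i : ι) (x : X) : Subgroup Γ :=
  (G i ⊓ MulAction.stabilizer Γ x).comap (MulAut.conj (D.τ x)).toMonoidHom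

theorem mem_vert {i : ι} {x : X} {a : Γ} :
    a ∈ D.vert i x ↔ D.τ x * a * (D.τ x)⁻¹ ∈ G i ∧ (D.τ x * a * (D.τ x)⁻¹) • x = x := Iff.rfl

theorem conj_mem_vert {i : ι} {x : X} {g : Γ} (hg : g ∈ G i) (hx : g • x = x) :
    (D.τ x)⁻¹ * g * D.τ x ∈ D.vert i x := by
  rw [mem_vert, show D.τ x * ((D.τ x)⁻¹ * g * D.τ x) * (D.τ x)⁻¹ = g by group]
  exact ⟨hg, hx⟩

theorem vert_le (i : ι) (x : X) : D.vert i x ≤ MulAction.stabilizer Γ x₀ := by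
  intro a ha
  have h := (D.mem_vert.1 ha).2
  have hx : (D.τ x)⁻¹ • x = x₀ := by rw [inv_smul_eq_iff, D.τ_smul]
  rw [mul_smul, hx, mul_smul] at h
  rw [MulAction.mem_stabilizer_iff, eq_inv_smul_iff.2 h, hx]

theorem t_mem (i : ι) (x : X) : D.t i x ∈ MulAction.stabilizer Γ x₀ := by
  rw [MulAction.mem_stabilizer_iff, t, mul_smul, mul_smul, D.τ_smul, D.u_smul, inv_smul_eq_iff,
    D.τ_smul]

/-- The part in the vertex group at `r i x` of an element `g ∈ G i` that moves `x`. -/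
def corner (i : ι) (g : Γ) (x : X) : Γ :=
  (D.τ (D.r i x))⁻¹ * ((D.u i (g • x))⁻¹ * g * D.u i x) * D.τ (D.r i x)

theorem corner_mem {i : ι} {g : Γ} (hg : g ∈ G i) (x : X) :
    D.corner i g x ∈ D.vert i (D.r i x) := by
  refine D.conj_mem_vert (mul_mem (mul_mem (inv_mem (D.u_mem _ _)) hg) (D.u_mem _ _)) ?_
  rw [mul_smul, mul_smul, D.u_smul, inv_smul_eq_iff]
  conv_lhs => rw [← D.u_smul i (g • x), D.r_smul i g hg]

/-- Arbitrary values on the vertex groups and on the edges, subject to being trivial on the edges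
of the spanning tree, are taken by a cocycle on `Γ`. -/
theorem exists_cocycle (h : IsInternalFreeProduct G) {K : Type*} [Group K] (ψ : ι → X → Γ → K)
    (f : ι → X → K)
    (hψ : ∀ i x, D.r i x = x → ∀ a ∈ D.vert i x, ∀ b ∈ D.vert i x,
      ψ i x (a * b) = ψ i x a * ψ i x b)
    (hf : ∀ i x, D.t i x = 1 → f i x = 1) :
    ∃ C : Γ → X → K, (∀ g g' x, C (g * g') x = C g (g' • x) * C g' x) ∧
      (∀ i, ∀ g ∈ G i, ∀ x,
        C g x = f i (g • x) * ψ i (D.r i x) (D.corner i g x) * (f i x)⁻¹) ∧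
      (∀ i x, D.r i x = x → ∀ a ∈ D.vert i x, C a x₀ = ψ i x a) ∧
      ∀ i x, C (D.t i x) x₀ = f i x := by
  obtain ⟨C, hC, hCG⟩ := h.exists_cocycle (X := X) (K := K)
    (fun i g x => f i (g • x) * ψ i (D.r i x) (D.corner i g x) * (f i x)⁻¹) (by
      intro i g hg g' hg' x
      have e : D.corner i (g * g') x = D.corner i g (g' • x) * D.corner i g' x := by
        simp only [corner, D.r_smul i g' hg', mul_smul]
        group
      have hm := D.corner_mem hg (g' • x)
      rw [D.r_smul i g' hg'] at hm
      rw [e, hψ i _ (D.r_r i x) _ hm _ (D.corner_mem hg' x), mul_smul, D.r_smul i g' hg']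
      group)
  have hψ1 : ∀ i x, D.r i x = x → ψ i x 1 = 1 := fun i x hx => by
    simpa using hψ i x hx 1 (one_mem _) 1 (one_mem _)
  have hC1 : ∀ x, C 1 x = 1 := fun x => by simpa using hC 1 1 x
  have hfr : ∀ i x, D.r i x = x → f i x = 1 := fun i x hx => hf i x (by
    rw [t, D.u_eq_one i x hx, hx]; group)
  have hu : ∀ i x, C (D.u i x) (D.r i x) = f i x := by
    intro i x
    rw [hCG i _ (D.u_mem i x), hfr i _ (D.r_r i x), D.u_smul, corner, D.u_smul, D.r_r,
      D.u_eq_one i _ (D.r_r i x)]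
    simp [hψ1 i _ (D.r_r i x)]
  have hτ : ∀ x, C (D.τ x) x₀ = 1 := by
    intro x
    refine D.tree_induction (p := fun x => C (D.τ x) x₀ = 1) ?_ (fun x i hx ih => ?_) x
    · rw [D.τ_base, hC1]
    · rw [hx, hC, ih, D.τ_smul, hu, mul_one]
      exact hf i x (by rw [t, hx]; group)
  have hτi : ∀ x, C (D.τ x)⁻¹ x = 1 := by
    intro x
    have := hC (D.τ x)⁻¹ (D.τ x) x₀
    rwa [inv_mul_cancel, hC1, hτ, mul_one, D.τ_smul, eq_comm] at this
  refine ⟨C, hC, hCG, fun i x hx a ha => ?_, fun i x => ?_⟩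
  · obtain ⟨ha1, ha2⟩ := D.mem_vert.1 ha
    have e : a = (D.τ x)⁻¹ * ((D.τ x * a * (D.τ x)⁻¹) * D.τ x) := by group
    rw [e, hC, hC, hτ, mul_one, mul_smul, D.τ_smul, ha2, hτi, one_mul, hCG i _ ha1, ha2,
      hfr i x hx, hx, corner, ha2, D.u_eq_one i x hx, hx]
    simp only [one_mul, inv_one, mul_one, mul_assoc]
  · rw [t, mul_assoc, hC, hC, hτ, mul_one, mul_smul, D.τ_smul, D.u_smul, hτi, one_mul, hu]

/-- The index set of the Kurosh decomposition: the orbit representatives of the factors, and the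
edges outside of the spanning tree, which are those with nontrivial loops. -/
abbrev Index : Type _ :=
  {p : ι × X // D.r p.1 p.2 = p.2} ⊕ {p : ι × X // D.t p.1 p.2 ≠ 1}

/-- The factors of the Kurosh decomposition of the stabilizer of the base point. -/
def factor : D.Index → Subgroup Γ :=
  Sum.elim (fun p => D.vert p.1.1 p.1.2) (fun p => Subgroup.zpowers (D.t p.1.1 p.1.2))

/-- A cocycle restricts to a homomorphism on the stabilizer of a point. -/
theorem cocycle_zpow {K : Type*} [Group K] {C : Γ → X → K}
    (hC : ∀ g g' x, C (g * g') x = C g (g' • x) * C g' x) {g : Γ}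
    (hg : g ∈ MulAction.stabilizer Γ x₀) (n : ℤ) : C (g ^ n) x₀ = C g x₀ ^ n := by
  let φ : MulAction.stabilizer Γ x₀ →* K := MonoidHom.mk' (fun a => C a x₀) (by
    intro a b
    rw [Subgroup.coe_mul, hC, MulAction.mem_stabilizer_iff.1 b.2])
  exact map_zpow φ ⟨g, hg⟩ n

/-- Counting the passages through an edge outside of the spanning tree shows that the loop of this
edge has infinite order. -/
theorem isInfiniteCyclic_t (h : IsInternalFreeProduct G) {i : ι} {x : X} (ht : D.t i x ≠ 1) :
    IsInfiniteCyclic (Subgroup.zpowers (D.t i x)) := by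
  classical
  obtain ⟨C, hC, -, -, hCt⟩ := D.exists_cocycle h (K := Multiplicative ℤ) (fun _ _ _ => 1)
    (fun j y => if (j, y) = (i, x) then Multiplicative.ofAdd 1 else 1) (by simp) (by
      intro j y hy
      rw [if_neg]
      rintro ⟨⟩
      exact ht hy)
  refine isInfiniteCyclic_zpowers (fun g => (C g x₀).toAdd) fun n => ?_
  rw [cocycle_zpow hC (D.t_mem i x), hCt, if_pos rfl]
  simp

/-- **Kurosh subgroup theorem**: the stabilizer of the base point is the free product of the
vertex groups at the orbit representatives and the infinite cyclic groups of the edges outside of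
the spanning tree. The inverse `φ` of the canonical homomorphism is the cocycle with the
tautological values; as a function on `Γ`, it is multiplicative only on the stabilizer. -/
theorem kurosh (h : IsInternalFreeProduct G) :
    ⨆ s, D.factor s = MulAction.stabilizer Γ x₀ ∧
    ∃ φ : Γ → Monoid.CoprodI (fun s => D.factor s),
      (∀ a ∈ MulAction.stabilizer Γ x₀, ∀ b ∈ MulAction.stabilizer Γ x₀,
        φ (a * b) = φ a * φ b) ∧
      ∀ s, ∀ a ∈ D.factor s, φ a = coprodOf D.factor s a := by
  classical
  obtain ⟨C, hC, hCG, hCv, hCt⟩ := D.exists_cocycle h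
    (K := Monoid.CoprodI (fun s => D.factor s))
    (fun i x => if hx : D.r i x = x then coprodOf D.factor (Sum.inl ⟨(i, x), hx⟩) else 1)
    (fun i x => if ht : D.t i x ≠ 1 then
      coprodOf D.factor (Sum.inr ⟨(i, x), ht⟩) (D.t i x) else 1)
    (by
      intro i x hx a ha b hb
      simp only [dif_pos hx]
      exact coprodOf_mul (F := D.factor) (i := Sum.inl ⟨(i, x), hx⟩) ha hb)
    (fun i x ht => dif_neg (not_not.2 ht))
  refine ⟨le_antisymm (iSup_le ?_) fun g hg => ?_, fun g => C g x₀, fun a _ b hb => ?_, ?_⟩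
  · rintro (p | p)
    · exact D.vert_le _ _
    · exact (Subgroup.zpowers_le).2 (D.t_mem _ _)
  · let θ := Monoid.CoprodI.lift (fun s => (D.factor s).subtype)
    have hθt : ∀ i x, θ (if ht : D.t i x ≠ 1 then
        coprodOf D.factor (Sum.inr ⟨(i, x), ht⟩) (D.t i x) else 1) = D.t i x := by
      intro i x
      by_cases ht : D.t i x ≠ 1
      · rw [dif_pos ht]
        exact lift_coprodOf (F := D.factor) (i := Sum.inr ⟨(i, x), ht⟩)
          (Subgroup.mem_zpowers (D.t i x))
      · rw [dif_neg ht, map_one, not_not.1 ht]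
    -- `θ` turns the cocycle into the one that compares `g` with the spanning tree
    have key : ∀ g x, θ (C g x) = (D.τ (g • x))⁻¹ * g * D.τ x := by
      intro g
      induction g using h.induction with
      | one => intro x; rw [show C 1 x = 1 by simpa using hC 1 1 x]; simp
      | mul g g' h1 h2 => intro x; rw [hC, map_mul, h1, h2, mul_smul]; group
      | mem i g hg =>
        intro x
        rw [hCG i g hg, dif_pos (D.r_r i x), map_mul, map_mul, map_inv, hθt, hθt]
        have := lift_coprodOf (F := D.factor) (i := Sum.inl ⟨(i, D.r i x), D.r_r i x⟩)
          (D.corner_mem hg x)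
        rw [show θ _ = _ from this, t, t, corner, D.r_smul i g hg]
        group
    have h1 := key g x₀
    rw [MulAction.mem_stabilizer_iff.1 hg, D.τ_base, inv_one, one_mul, mul_one] at h1
    have h2 : θ (C g x₀) ∈ θ.range := ⟨_, rfl⟩
    rw [Monoid.CoprodI.range_eq_iSup, h1] at h2
    simpa using h2
  · change C (a * b) x₀ = _
    rw [hC, MulAction.mem_stabilizer_iff.1 hb]
  · rintro (⟨⟨i, x⟩, hx⟩ | ⟨⟨i, x⟩, ht⟩) a ha
    · exact (hCv i x hx a ha).trans (congrFun (dif_pos hx) a)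
    · obtain ⟨n, rfl⟩ := Subgroup.mem_zpowers_iff.1 ha
      have hmem := Subgroup.mem_zpowers (D.t i x)
      have e := coprodOf_of_mem (F := D.factor) (i := Sum.inr ⟨(i, x), ht⟩) ha
      rw [e]
      change C (D.t i x ^ n) x₀ = _
      rw [cocycle_zpow hC (D.t_mem i x), hCt, dif_pos ht,
        coprodOf_of_mem (F := D.factor) (i := Sum.inr ⟨(i, x), ht⟩) hmem, ← map_zpow]
      rfl

end TransversalSystem

/-! ### Realizations with cyclic cofactors -/

section InfiniteCyclic

theorem IsInfiniteCyclic.exists_log {Γ : Type*} [Group Γ] {Z : Subgroup Γ}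
    (h : IsInfiniteCyclic Z) :
    ∃ (z : Γ) (log : Γ → ℤ), Z = Subgroup.zpowers z ∧ ∀ n : ℤ, log (z ^ n) = n := by
  obtain ⟨hc, hi⟩ := h
  obtain ⟨z, hz⟩ := (Subgroup.isCyclic_iff_exists_zpowers_eq_top Z).1 hc
  subst hz
  have hinj := injective_zpow_iff_not_isOfFinOrder.2 
    (infinite_zpowers.1 (Set.infinite_coe_iff.1 hi))
  exact ⟨z, Function.invFun (fun n : ℤ => z ^ n), rfl, Function.leftInverse_invFun hinj⟩

theorem IsInfiniteCyclic.ne_bot {Γ : Type*} [Group Γ] {Z : Subgroup Γ}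
    (h : IsInfiniteCyclic Z) : Z ≠ ⊥ := by
  rintro rfl
  obtain ⟨-, hi⟩ := h
  exact not_finite (⊥ : Subgroup Γ)

theorem IsInfiniteCyclic.of_injective {Z W : Type*} [Group Z] [Group W] [Nontrivial W]
    (h : IsInfiniteCyclic Z) (f : W →* Z) (hf : Function.Injective f) : IsInfiniteCyclic W := by
  obtain ⟨hc, hi⟩ := h
  refine ⟨isCyclic_of_injective f hf, ?_⟩
  obtain ⟨w, hw⟩ := exists_ne (1 : W)
  let e := (intCyclicMulEquiv (G := Z)).symm
  have hne : (e (f w)).toAdd ≠ 0 := by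
    intro h0
    have : e (f w) = 1 := h0
    rw [← map_one e, e.apply_eq_iff_eq, ← map_one f] at this
    exact hw (hf this)
  refine Infinite.of_injective (fun n : ℤ => w ^ n) fun m n hmn => ?_
  have h1 : (e (f (w ^ m))).toAdd = (e (f (w ^ n))).toAdd := by
    have hmn' : w ^ m = w ^ n := hmn
    rw [hmn']
  simp only [map_zpow, toAdd_zpow, smul_eq_mul] at h1
  exact mul_right_cancel₀ hne h1

theorem IsInfiniteCyclic.congr {Z W : Type*} [Group Z] [Group W] (h : IsInfiniteCyclic Z)
    (e : Z ≃* W) : IsInfiniteCyclic W := by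
  obtain ⟨hc, hi⟩ := h
  exact ⟨isCyclic_of_surjective e e.surjective, Infinite.of_injective e e.injective⟩

theorem IsInfiniteCyclic.freeGroup {X : Type*} [Unique X] : IsInfiniteCyclic (FreeGroup X) := by
  have e : FreeGroup X ≃* Multiplicative ℤ :=
    (FreeGroup.freeGroupCongr (Equiv.ofUnique X Unit)).trans
      FreeGroup.mulEquivIntOfUnique
  exact IsInfiniteCyclic.congr (Z := Multiplicative ℤ) ⟨inferInstance, inferInstance⟩ e.symm

end InfiniteCyclic

section ConjClass

variable {Γ : Type*} [Group Γ]

theorem conjClass_eq_iff {A B : Subgroup Γ} :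
    conjClass A = conjClass B ↔ ∃ g : Γ, ∀ x, x ∈ A ↔ g * x * g⁻¹ ∈ B := by
  constructor
  · intro h
    obtain ⟨c, hc⟩ := Quotient.exact h.symm
    refine ⟨ConjAct.ofConjAct c, fun x => ?_⟩
    rw [← (show c • A = B from hc), ← ConjAct.smul_def c x, Subgroup.smul_mem_pointwise_smul_iff]
  · rintro ⟨g, hg⟩
    symm
    refine Quotient.sound ⟨ConjAct.toConjAct g, ?_⟩
    ext y
    change y ∈ ConjAct.toConjAct g • A ↔ _
    rw [Subgroup.mem_pointwise_smul_iff_inv_smul_mem, hg, ← ConjAct.toConjAct_inv,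
      ConjAct.smul_def, ConjAct.ofConjAct_toConjAct]
    group

theorem contained_conjClass_iff {A B : Subgroup Γ} :
    (conjClass A).Contained (conjClass B) ↔ ∃ g : Γ, ∀ x ∈ A, g * x * g⁻¹ ∈ B := by
  constructor
  · rintro ⟨A', B', hA, hB, hle⟩
    obtain ⟨a, ha⟩ := conjClass_eq_iff.1 hA.symm
    obtain ⟨b, hb⟩ := conjClass_eq_iff.1 hB
    refine ⟨b * a, fun x hx => ?_⟩
    have := (hb _).1 (hle ((ha x).1 hx))
    rwa [show b * (a * x * a⁻¹) * b⁻¹ = b * a * x * (b * a)⁻¹ by group] at this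
  · rintro ⟨g, hg⟩
    refine ⟨A, B.comap (MulAut.conj g).toMonoidHom, rfl, ?_, hg⟩
    exact conjClass_eq_iff.2 ⟨g, fun x => Iff.rfl⟩

theorem contained_of_le {A B : Subgroup Γ} (h : A ≤ B) :
    (conjClass A).Contained (conjClass B) := ⟨A, B, rfl, rfl, h⟩

theorem exists_conjClass_eq (a : SubgroupConjClass Γ) : ∃ A, conjClass A = a :=
  Quotient.exists_rep a

end ConjClass

/-- A realization whose cofactor is split into infinite cyclic factors `Z l`. -/
structure IsFineRealization {Γ : Type*} [Group Γ] (S : Set (SubgroupConjClass Γ)) {α β : Type*}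
    (A : α → Subgroup Γ) (Z : β → Subgroup Γ) : Prop where
  components_eq : S = Set.range (fun i => conjClass (A i))
  ne_bot : ∀ i, A i ≠ ⊥
  cyclic : ∀ l, IsInfiniteCyclic (Z l)
  isInternalFreeProduct : IsInternalFreeProduct (Sum.elim A Z)

section Cofactor

variable {Γ α β : Type*} [Group Γ] {A : α → Subgroup Γ}

/-- A basis splits a free cofactor into infinite cyclic factors. -/
theorem exists_split_cofactor {B : Subgroup Γ}
    (h : IsInternalFreeProduct (fun o : Option α => o.elim B A)) (e : B ≃* FreeGroup β) :
    ∃ Z : β → Subgroup Γ, (∀ l, IsInfiniteCyclic (Z l)) ∧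
      IsInternalFreeProduct (Sum.elim A Z) := by
  classical
  let z : β → B := fun l => e.symm (FreeGroup.of l)
  let Z : β → Subgroup Γ := fun l => Subgroup.zpowers (z l : Γ)
  have hZB : ∀ l, Z l ≤ B := fun l => Subgroup.zpowers_le.2 (z l).2
  let F : α ⊕ β → Subgroup Γ := Sum.elim A Z
  let lg : β → B →* Multiplicative ℤ := fun l => (FreeGroup.lift
    (fun j => if j = l then Multiplicative.ofAdd 1 else 1)).comp e.toMonoidHom
  have hlg : ∀ l, lg l (z l) = Multiplicative.ofAdd 1 := by
    intro l
    simp [lg, z]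
  refine ⟨Z, fun l => ?_, ?_⟩
  · refine isInfiniteCyclic_zpowers (fun x => if hx : x ∈ B then (lg l ⟨x, hx⟩).toAdd else 0)
      fun n => ?_
    have hn : (z l : Γ) ^ n ∈ B := zpow_mem (z l).2 n
    rw [dif_pos hn, show (⟨(z l : Γ) ^ n, hn⟩ : B) = z l ^ n from rfl, map_zpow, hlg]
    simp
  · let μ : B →* Monoid.CoprodI (fun s => F s) := (FreeGroup.lift
      (fun l => coprodOf F (Sum.inr l) (z l : Γ))).comp e.toMonoidHom
    have hμ : ∀ l, μ (z l) = coprodOf F (Sum.inr l) (z l : Γ) := by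
      intro l
      simp [μ, z]
    refine h.refine (F := F) ?_
      (fun o x => o.elim (if hx : x ∈ B then μ ⟨x, hx⟩ else 1)
        (fun i => coprodOf F (Sum.inl i) x)) ?_
      (Sum.elim some (fun _ => none)) ?_ ?_
    · rw [eq_top_iff, ← h.iSup_eq_top]
      refine iSup_le fun o => ?_
      cases o with
      | some i => exact le_iSup F (Sum.inl i)
      | none =>
        intro x hx
        have key : ∀ w : FreeGroup β, ((e.symm w : B) : Γ) ∈ ⨆ s, F s := by
          intro w
          induction w using FreeGroup.induction_on with
          | C1 => simp
          | of l => exact le_iSup F (Sum.inr l) (Subgroup.mem_zpowers (z l : Γ))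
          | inv_of l h => simpa using h
          | mul a b ha hb => simpa using mul_mem ha hb
        simpa using key (e ⟨x, hx⟩)
    · rintro (_ | i) x hx y hy
      · have hx' : x ∈ B := hx
        have hy' : y ∈ B := hy
        simp only [Option.elim_none, dif_pos hx', dif_pos hy', dif_pos (mul_mem hx' hy')]
        rw [← map_mul]
        rfl
      · exact coprodOf_mul (F := F) (i := Sum.inl i) hx hy
    · rintro (i | l)
      · exact le_rfl
      · exact hZB l
    · rintro (i | l) x hx
      · rfl
      · have hx' : x ∈ B := hZB l hx
        obtain ⟨n, rfl⟩ := Subgroup.mem_zpowers_iff.1 hx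
        change dite _ _ _ = _
        rw [dif_pos hx', show (⟨(z l : Γ) ^ n, hx'⟩ : B) = z l ^ n from rfl, map_zpow, hμ,
          coprodOf_of_mem (F := F) (i := Sum.inr l) hx,
          coprodOf_of_mem (F := F) (i := Sum.inr l) (Subgroup.mem_zpowers (z l : Γ)),
          ← map_zpow]
        rfl

/-- Conversely, infinite cyclic factors generate a free cofactor. -/
theorem exists_merged_cofactor {Z : β → Subgroup Γ} (h : IsInternalFreeProduct (Sum.elim A Z))
    (hZ : ∀ l, IsInfiniteCyclic (Z l)) :
    ∃ B : Subgroup Γ, IsInternalFreeProduct (fun o : Option α => o.elim B A) ∧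
      Nonempty (B ≃* FreeGroup β) := by
  choose z log hz hlog using fun l => (hZ l).exists_log
  refine ⟨⨆ l, Z l, ?_, ?_⟩
  · convert h.merge (Sum.elim some (fun _ => none)) using 1
    funext o
    cases o with
    | none =>
      refine le_antisymm (iSup_le fun l => ?_) (iSup_le ?_)
      · exact le_iSup (fun s : {s : α ⊕ β // Sum.elim some (fun _ => none) s = none} =>
          Sum.elim A Z s) ⟨Sum.inr l, rfl⟩
      · rintro ⟨i | l, hs⟩
        · simp at hs
        · exact le_iSup Z l
    | some i =>
      refine le_antisymm ?_ (iSup_le ?_)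
      · exact le_iSup (fun s : {s : α ⊕ β // Sum.elim some (fun _ => none) s = some i} =>
          Sum.elim A Z s) ⟨Sum.inl i, rfl⟩
      · rintro ⟨j | l, hs⟩
        · simp only [Sum.elim_inl, Option.some.injEq] at hs
          subst hs
          exact le_rfl
        · simp at hs
  · let f : FreeGroup β →* Γ := FreeGroup.lift z
    obtain ⟨Φ, hΦ⟩ := h.exists_hom_group (K := FreeGroup β)
      (Sum.elim (fun _ _ => 1) (fun l x => FreeGroup.of l ^ log l x)) (by
        rintro (i | l) x hx y hy
        · simp
        · simp only [Sum.elim_inr, hz] at hx hy ⊢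
          obtain ⟨m, rfl⟩ := Subgroup.mem_zpowers_iff.1 hx
          obtain ⟨n, rfl⟩ := Subgroup.mem_zpowers_iff.1 hy
          rw [← zpow_add, hlog, hlog, hlog, zpow_add])
    have hf : Function.LeftInverse Φ f := by
      intro w
      have : Φ.comp f = MonoidHom.id _ := by
        ext l
        have h1 : z l ∈ Z l := by rw [hz l]; exact Subgroup.mem_zpowers _
        have h2 : log l (z l) = 1 := by simpa using hlog l 1
        have := hΦ (Sum.inr l) (z l) h1
        simpa [f, h2] using this
      exact DFunLike.congr_fun this w
    have hr : f.range = ⨆ l, Z l := by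
      rw [FreeGroup.range_lift_eq_closure, ← Set.iUnion_singleton_eq_range, Subgroup.closure_iUnion]
      simp only [hz, Subgroup.zpowers_eq_closure]
    exact ⟨((MonoidHom.ofInjective hf.injective).trans
      (MulEquiv.subgroupCongr hr)).symm⟩

end Cofactor

namespace IsFineRealization

variable {Γ : Type*} [Group Γ] {S : Set (SubgroupConjClass Γ)} {α β : Type*}
  {A : α → Subgroup Γ} {Z : β → Subgroup Γ}

theorem reindex (h : IsFineRealization S A Z) {α' β' : Type*} (a : α' ≃ α) (b : β' ≃ β) :
    IsFineRealization S (A ∘ a) (Z ∘ b) where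
  components_eq := by
    rw [h.components_eq]
    exact (a.surjective.range_comp _).symm
  ne_bot i := h.ne_bot _
  cyclic l := h.cyclic _
  isInternalFreeProduct := by
    convert h.isInternalFreeProduct.reindex (Sum.map a b)
      (a.injective.sumMap b.injective)
      (fun s hs => absurd ((a.surjective.sumMap b.surjective) s) hs) using 1
    funext s
    cases s <;> rfl

/-- Distinct components are not conjugate, by malnormality. -/
theorem injective_conjClass (h : IsFineRealization S A Z) :
    Function.Injective (fun i => conjClass (A i)) := by
  intro i j hij
  obtain ⟨g, hg⟩ := conjClass_eq_iff.1 hij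
  obtain ⟨x, hx, hx1⟩ := (A i).bot_or_exists_ne_one.resolve_left (h.ne_bot i)
  have := (h.isInternalFreeProduct.malnormal (i := Sum.inl i) (j := Sum.inl j) (g := g)
    hx hx1 ((hg x).1 hx)).1
  exact Sum.inl_injective this

theorem exists_isRealization (h : IsFineRealization S A Z) [Finite α] [Finite β] :
    ∃ (A' : Fin (Nat.card α) → Subgroup Γ) (B : Subgroup Γ), IsRealization S A' B ∧
      Nonempty (B ≃* FreeGroup (Fin (Nat.card β))) := by
  have h' := h.reindex (Finite.equivFin α).symm (Finite.equivFin β).symm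
  obtain ⟨B, hB, e⟩ := exists_merged_cofactor h'.isInternalFreeProduct h'.cyclic
  exact ⟨_, B, ⟨h'.components_eq, h'.ne_bot, hB⟩, e⟩

theorem exists_system (h : IsFineRealization S A Z) [Finite α] [Finite β] :
    ∃ 𝒜 : FreeFactorSystem Γ, 𝒜.components = S := by
  obtain ⟨A', B, h1, e⟩ := h.exists_isRealization
  exact ⟨⟨S, _, A', B, h1, _, e⟩, rfl⟩

theorem depth_eq {𝒜 : FreeFactorSystem Γ} (h : IsFineRealization 𝒜.components A Z) [Finite α]
    [Finite β] : 𝒜.depth = 2 * (Nat.card β : ℤ) + (Nat.card α : ℤ) - 1 := by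
  obtain ⟨A', B, h1, ⟨e⟩⟩ := h.exists_isRealization
  have : 𝒜.components.ncard = Nat.card α := by
    rw [h.components_eq, ← Nat.card_coe_set_eq, Nat.card_range_of_injective h.injective_conjClass]
  rw [FreeFactorSystem.depth, 𝒜.corank_eq h1 e, this]

end IsFineRealization

theorem FreeFactorSystem.exists_fineRealization {Γ : Type*} [Group Γ] (𝒜 : FreeFactorSystem Γ) :
    ∃ (k n : ℕ) (A : Fin k → Subgroup Γ) (Z : Fin n → Subgroup Γ),
      IsFineRealization 𝒜.components A Z := by
  obtain ⟨k, A, B, ⟨h1, h2, h3⟩, n, ⟨e⟩⟩ := 𝒜.exists_realization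
  obtain ⟨Z, hZ, h⟩ := exists_split_cofactor h3 e
  exact ⟨k, n, A, Z, h1, h2, hZ, h⟩

/-! ### Compatible realizations and steps of depth one -/

theorem stabilizer_quotient_one {Γ : Type*} [Group Γ] (H : Subgroup Γ) :
    MulAction.stabilizer Γ ((1 : Γ) : Γ ⧸ H) = H := MulAction.stabilizer_quotient H

namespace IsInternalFreeProduct

variable {Γ ι κ : Type*} [Group Γ] {G : ι → Subgroup Γ} {H : κ → Subgroup Γ}

/-- Kurosh decompositions of all factors of a second free product decomposition of `Γ` refine that
decomposition. -/
theorem kurosh_refinement (hG : IsInternalFreeProduct G) (hH : IsInternalFreeProduct H)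
    (D : ∀ k, TransversalSystem G ((1 : Γ) : Γ ⧸ H k)) :
    IsInternalFreeProduct (fun s : Σ k, (D k).Index => (D s.1).factor s.2) := by
  let F : (Σ k, (D k).Index) → Subgroup Γ := fun s => (D s.1).factor s.2
  have hk := fun k => (D k).kurosh hG
  simp only [stabilizer_quotient_one] at hk
  choose hsup φ hφ hof using hk
  have hle : ∀ s, F s ≤ H s.1 := fun s => by
    rw [← hsup s.1]
    exact le_iSup (fun j => (D s.1).factor j) s.2
  let emb : ∀ k, Monoid.CoprodI (fun s => (D k).factor s) →* Monoid.CoprodI (fun s => F s) :=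
    fun k => Monoid.CoprodI.lift (fun s => Monoid.CoprodI.of (M := fun s => F s) (i := ⟨k, s⟩))
  refine hH.refine (F := F) ?_ (fun k x => emb k (φ k x)) (fun k x hx y hy => ?_) Sigma.fst hle
    (fun s x hx => ?_)
  · rw [eq_top_iff, ← hH.iSup_eq_top]
    refine iSup_le fun k => ?_
    rw [← hsup k]
    exact iSup_le fun s => le_iSup F ⟨k, s⟩
  · rw [hφ k x hx y hy, map_mul]
  · obtain ⟨k, s⟩ := s
    rw [hof k s x hx, coprodOf_of_mem (F := F) (i := ⟨k, s⟩) hx,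
      coprodOf_of_mem (F := (D k).factor) (i := s) hx]
    exact Monoid.CoprodI.lift_of (M := fun s => (D k).factor s)
      (fun s => Monoid.CoprodI.of (M := fun s => F s) (i := ⟨k, s⟩)) (i := s) ⟨x, hx⟩

/-- If the members of a generating family lie in factors of a free product, then each factor is
generated by the members that lie in it. -/
theorem le_iSup_of_le (hH : IsInternalFreeProduct H) (htop : ⨆ i, G i = ⊤) (o : ι → κ)
    (hle : ∀ i, G i ≤ H (o i)) (k : κ) : H k ≤ ⨆ i : {i // o i = k}, G i := by
  obtain ⟨ρ, hρ, hρ'⟩ := hH.exists_projection k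
  intro x hx
  rw [← hρ x hx]
  have hx' : x ∈ ⨆ i, G i := htop ▸ Subgroup.mem_top x
  refine Subgroup.iSup_induction G (C := fun x => ρ x ∈ ⨆ i : {i // o i = k}, G i) hx' ?_ ?_ ?_
  · intro i y hy
    by_cases hi : o i = k
    · rw [hρ y (hi ▸ hle i hy)]
      exact le_iSup (fun i : {i // o i = k} => G i) ⟨i, hi⟩ hy
    · rw [hρ' _ hi y (hle i hy)]
      exact one_mem _
  · rw [map_one]
    exact one_mem _
  · intro y z hy hz
    rw [map_mul]
    exact mul_mem hy hz

end IsInternalFreeProduct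

namespace IsFineRealization

variable {Γ : Type*} [Group Γ] {S : Set (SubgroupConjClass Γ)} {α β : Type*}
  {A : α → Subgroup Γ} {Z : β → Subgroup Γ}

/-- Given a second free product decomposition such that each `A i` is conjugate into one of its
factors, there is a fine realization each of whose terms lies in one of those factors. It consists
of the nontrivial factors of the Kurosh decompositions of the `H k`. By malnormality, `A i` has a
single fixed point in the union of the `Γ ⧸ H k`, and acts freely elsewhere, so that it contributes
exactly one conjugate of itself; the other nontrivial factors are infinite cyclic. -/
theorem exists_compatible.{u, v, w, t} {Γ : Type u} [Group Γ] {S : Set (SubgroupConjClass Γ)}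
    {α : Type v} {β : Type w} {κ : Type t} {A : α → Subgroup Γ} {Z : β → Subgroup Γ}
    {H : κ → Subgroup Γ} (h : IsFineRealization S A Z) (hH : IsInternalFreeProduct H) (o : α → κ)
    (g : α → Γ) (hg : ∀ i, ∀ x ∈ A i, g i * x * (g i)⁻¹ ∈ H (o i)) :
    ∃ (A' : α → Subgroup Γ) (β' : Type (max u v w t))
      (Z' : β' → Subgroup Γ) (o' : β' → κ),
      IsFineRealization S A' Z' ∧ (∀ i, A' i ≤ H (o i)) ∧ ∀ l, Z' l ≤ H (o' l) := by
  have hG := h.isInternalFreeProduct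
  let D : ∀ k, TransversalSystem (Sum.elim A Z) ((1 : Γ) : Γ ⧸ H k) := fun k =>
    (hG.exists_transversalSystem _).some
  have hF := hG.kurosh_refinement hH D
  set F : (Σ k, (D k).Index) → Subgroup Γ := fun s => (D s.1).factor s.2
  have hle : ∀ s, F s ≤ H s.1 := fun s => by
    have := le_iSup (fun j => (D s.1).factor j) s.2
    rwa [((D s.1).kurosh hG).1, stabilizer_quotient_one] at this
  -- the fixed point of `A i` on `Γ ⧸ H (o i)`
  let x : ∀ i, Γ ⧸ H (o i) := fun i => (((g i)⁻¹ : Γ) : Γ ⧸ H (o i))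
  have hfix : ∀ i, ∀ a ∈ A i, a • x i = x i := by
    intro i a ha
    refine QuotientGroup.eq.2 ?_
    change (a * (g i)⁻¹)⁻¹ * (g i)⁻¹ ∈ H (o i)
    convert hg i a⁻¹ (inv_mem ha) using 1
    group
  have hr : ∀ i, (D (o i)).r (Sum.inl i) (x i) = x i := by
    intro i
    have h1 := (D (o i)).u_smul (Sum.inl i) (x i)
    have h2 := hfix i _ (inv_mem ((D (o i)).u_mem (Sum.inl i) (x i)))
    rw [← eq_inv_smul_iff] at h1
    exact h1.trans h2
  let sα : α → Σ k, (D k).Index := fun i => ⟨o i, Sum.inl ⟨(Sum.inl i, x i), hr i⟩⟩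
  have hmem : ∀ i a, a ∈ F (sα i) ↔ (D (o i)).τ (x i) * a * ((D (o i)).τ (x i))⁻¹ ∈ A i := by
    intro i a
    exact ⟨fun ha => ha.1, fun ha => ⟨ha, hfix i _ ha⟩⟩
  have hconj : ∀ i, conjClass (F (sα i)) = conjClass (A i) := fun i =>
    conjClass_eq_iff.2 ⟨_, hmem i⟩
  have hinj : Function.Injective sα := by
    intro i j hij
    have h1 := (hconj i).symm.trans ((congrArg (fun s => conjClass (F s)) hij).trans (hconj j))
    exact h.injective_conjClass h1
  -- the other factors are trivial or infinite cyclic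
  have hcyc : ∀ s, F s ≠ ⊥ → s ∉ Set.range sα → IsInfiniteCyclic (F s) := by
    rintro ⟨k, ⟨⟨i | l, y⟩, hy⟩ | ⟨⟨i, y⟩, ht⟩⟩ hbot hs
    · -- by malnormality, a point with nontrivial stabilizer in `A i` is the fixed point
      exfalso
      apply hs
      obtain ⟨a, ha, ha1⟩ := (Subgroup.bot_or_exists_ne_one _).resolve_left hbot
      have hak := hle _ ha
      obtain ⟨haA, -⟩ := ha
      change (D k).τ y * a * ((D k).τ y)⁻¹ ∈ A i at haA
      have h1 := hg i _ haA
      rw [show g i * ((D k).τ y * a * ((D k).τ y)⁻¹) * (g i)⁻¹ =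
        (g i * (D k).τ y) * a * (g i * (D k).τ y)⁻¹ by group] at h1
      obtain ⟨hk, hm⟩ := hH.malnormal hak ha1 h1
      change k = o i at hk
      subst hk
      have hxy : x i = y := by
        rw [← (D (o i)).τ_smul y]
        refine QuotientGroup.eq.2 ?_
        simpa using hm
      subst hxy
      exact ⟨i, rfl⟩
    · have : Nontrivial (F ⟨k, Sum.inl ⟨(Sum.inr l, y), hy⟩⟩) :=
        (Subgroup.nontrivial_iff_ne_bot _).2 hbot
      refine (h.cyclic l).of_injective
        (((MulAut.conj ((D k).τ y)).toMonoidHom.comp (Subgroup.subtype _)).codRestrict (Z l)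
          (fun a => a.2.1)) ?_
      intro a b hab
      have := congrArg Subtype.val hab
      exact Subtype.ext ((MulAut.conj ((D k).τ y)).injective this)
    · exact (D k).isInfiniteCyclic_t hG ht
  refine ⟨fun i => F (sα i), {s // F s ≠ ⊥ ∧ s ∉ Set.range sα}, fun s => F s, fun s => s.1.1,
    ⟨?_, fun i => ?_, fun s => hcyc s s.2.1 s.2.2, ?_⟩, fun i => hle (sα i), fun s => hle s⟩
  · simp only [hconj]
    exact h.components_eq
  · have h1 := h.ne_bot i
    intro h2
    apply h1
    rw [eq_bot_iff]
    intro a ha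
    have : ((D (o i)).τ (x i))⁻¹ * a * (D (o i)).τ (x i) ∈ F (sα i) := by
      rw [hmem]
      convert ha using 1
      group
    rw [h2, Subgroup.mem_bot] at this
    rw [Subgroup.mem_bot]
    exact (conj_eq_one_iff (a := ((D (o i)).τ (x i))⁻¹)).1 (by rwa [inv_inv])
  · convert hF.reindex (Sum.elim sα (fun s : {s // F s ≠ ⊥ ∧ s ∉ Set.range sα} => s.1))
      (hinj.sumElim Subtype.val_injective fun i s hs => s.2.2 ⟨i, hs⟩) ?_ using 1
    · funext s
      cases s <;> rfl
    · intro s hs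
      by_contra hbot
      by_cases h1 : s ∈ Set.range sα
      · obtain ⟨i, rfl⟩ := h1
        exact hs ⟨Sum.inl i, rfl⟩
      · exact hs ⟨Sum.inr ⟨s, hbot, h1⟩, rfl⟩

/-- Homomorphisms to `ℤ/2` that kill the components are determined by arbitrary values on the
cyclic factors, so their number bounds the number of cyclic factors. -/
theorem finite_of_finite (h : IsFineRealization S A Z) [Finite β] {α' β' : Type*}
    {A' : α' → Subgroup Γ} {Z' : β' → Subgroup Γ} (h' : IsFineRealization S A' Z') :
    Finite β' := by
  classical
  choose z log hz hlog using fun l => (h.cyclic l).exists_log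
  choose z' log' hz' hlog' using fun l => (h'.cyclic l).exists_log
  have hΦ : ∀ f : β' → Multiplicative (ZMod 2), ∃ Φ : Γ →* Multiplicative (ZMod 2),
      (∀ i, ∀ x ∈ A' i, Φ x = 1) ∧ ∀ l, Φ (z' l) = f l := by
    intro f
    obtain ⟨Φ, hΦ⟩ := h'.isInternalFreeProduct.exists_hom_group
      (Sum.elim (fun _ _ => 1) (fun l x => f l ^ log' l x)) (by
        rintro (i | l) x hx y hy
        · simp
        · simp only [Sum.elim_inr, hz'] at hx hy ⊢
          obtain ⟨m, rfl⟩ := Subgroup.mem_zpowers_iff.1 hx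
          obtain ⟨n, rfl⟩ := Subgroup.mem_zpowers_iff.1 hy
          rw [← zpow_add, hlog', hlog', hlog', zpow_add])
    refine ⟨Φ, fun i x hx => hΦ (Sum.inl i) x hx, fun l => ?_⟩
    have h1 : z' l ∈ Z' l := by rw [hz' l]; exact Subgroup.mem_zpowers _
    have h2 : log' l (z' l) = 1 := by simpa using hlog' l 1
    have := hΦ (Sum.inr l) (z' l) h1
    simpa [h2] using this
  choose Φ hΦA hΦz using hΦ
  have hkill : ∀ f i, ∀ x ∈ A i, Φ f x = 1 := by
    intro f i x hx
    have h1 : conjClass (A i) ∈ Set.range (fun i => conjClass (A' i)) := by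
      rw [← h'.components_eq, h.components_eq]
      exact ⟨i, rfl⟩
    obtain ⟨j, hj⟩ := h1
    obtain ⟨c, hc⟩ := conjClass_eq_iff.1 hj.symm
    have h2 := hΦA f j _ ((hc x).1 hx)
    rwa [map_mul, map_mul, map_inv, conj_eq_one_iff] at h2
  have hinj : Function.Injective (fun (f : β' → Multiplicative (ZMod 2)) (l : β) =>
      Φ f (z l)) := by
    intro f f' hff
    have : Φ f = Φ f' := by
      refine h.isInternalFreeProduct.hom_ext ?_
      rintro (i | l) x hx
      · rw [hkill f i x hx, hkill f' i x hx]
      · simp only [Sum.elim_inr, hz] at hx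
        obtain ⟨n, rfl⟩ := Subgroup.mem_zpowers_iff.1 hx
        rw [map_zpow, map_zpow, show Φ f (z l) = Φ f' (z l) from congrFun hff l]
    funext l
    rw [← hΦz f l, ← hΦz f' l, this]
  have : Finite (Multiplicative (ZMod 2)) := inferInstanceAs (Finite (ZMod 2))
  have hfin : Finite (β' → Multiplicative (ZMod 2)) := Finite.of_injective _ hinj
  refine Finite.of_injective
    (fun l : β' => (Pi.mulSingle l (Multiplicative.ofAdd (1 : ZMod 2)) :
      β' → Multiplicative (ZMod 2))) fun l l' hl => ?_
  by_contra hne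
  have := congrFun hl l
  simp only [Pi.mulSingle_eq_same, Pi.mulSingle_eq_of_ne hne] at this
  exact absurd this (by decide)

/-- A cyclic factor of the cofactor is turned into a component. -/
theorem promote [DecidableEq β] (h : IsFineRealization S A Z) (l : β) :
    IsFineRealization (Set.range fun i : Option α => conjClass (i.elim (Z l) A))
      (fun i : Option α => i.elim (Z l) A) (fun l' : {l' // l' ≠ l} => Z l') where
  components_eq := rfl
  ne_bot i := by
    cases i with
    | none => exact (h.cyclic l).ne_bot
    | some i => exact h.ne_bot i
  cyclic l' := h.cyclic l'
  isInternalFreeProduct := by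
    convert h.isInternalFreeProduct.reindex
      (Sum.elim (fun i : Option α => i.elim (Sum.inr l) Sum.inl)
        (fun l' : {l' // l' ≠ l} => Sum.inr l'.1)) ?_ ?_ using 1
    · funext s
      rcases s with (_ | i) | l' <;> rfl
    · refine Function.Injective.sumElim ?_ ?_ ?_
      · rintro (_ | i) (_ | j) hij <;> simp_all
      · intro a b hab
        exact Subtype.ext (Sum.inr_injective hab)
      · rintro (_ | i) ⟨l', hl'⟩
        · simpa using hl'.symm
        · simp
    · intro s hs
      exfalso
      apply hs
      rcases s with i | l'
      · exact ⟨Sum.inl (some i), rfl⟩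
      · by_cases hl : l' = l
        · exact ⟨Sum.inl none, by rw [hl]; rfl⟩
        · exact ⟨Sum.inr ⟨l', hl⟩, rfl⟩

/-- Components are merged along a surjection of index sets. -/
theorem merge (h : IsFineRealization S A Z) {α' : Type*} (π : α → α')
    (hπ : Function.Surjective π) :
    IsFineRealization (Set.range fun k => conjClass (⨆ i : {i // π i = k}, A i))
      (fun k => ⨆ i : {i // π i = k}, A i) Z where
  components_eq := rfl
  ne_bot k := by
    obtain ⟨i, rfl⟩ := hπ k
    intro hbot
    have := le_iSup (fun j : {j // π j = π i} => A j) ⟨i, rfl⟩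
    rw [hbot, le_bot_iff] at this
    exact h.ne_bot i this
  cyclic := h.cyclic
  isInternalFreeProduct := by
    convert h.isInternalFreeProduct.merge (Sum.map π id) using 1
    funext s
    rcases s with k | l
    · refine le_antisymm (iSup_le ?_) (iSup_le ?_)
      · rintro ⟨i, hi⟩
        exact le_iSup (fun s : {s // Sum.map π id s = Sum.inl k} => Sum.elim A Z s.1)
          ⟨Sum.inl i, by simp [hi]⟩
      · rintro ⟨i | l, hs⟩
        · exact le_iSup (fun i : {i // π i = k} => A i) ⟨i, by simpa using hs⟩
        · simp at hs
    · refine le_antisymm ?_ (iSup_le ?_)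
      · exact le_iSup (fun s : {s // Sum.map π id s = Sum.inr l} => Sum.elim A Z s.1)
          ⟨Sum.inr l, rfl⟩
      · rintro ⟨i | l', hs⟩
        · simp at hs
        · have : l' = l := by simpa using hs
          subst this
          exact le_rfl

end IsFineRealization

namespace FreeFactorSystem

variable {Γ : Type*} [Group Γ] {𝒜 ℬ 𝒞 : FreeFactorSystem Γ}

theorem exists_contained_of_mem_range {α : Type*} {A : α → Subgroup Γ}
    {S : Set (SubgroupConjClass Γ)} (hS : S = Set.range (fun i => conjClass (A i)))
    {B : Subgroup Γ} (i : α) (h : B ≤ A i) : ∃ b ∈ S, (conjClass B).Contained b :=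
  ⟨conjClass (A i), hS ▸ ⟨i, rfl⟩, contained_of_le h⟩

/-- A free factor system with a proper extension can be extended within it so that the depth
drops by exactly one. In a fine realization whose terms lie in the terms of a realization of the
larger system, either a cyclic factor or two components lie in the same component of the larger
system, unless the two systems agree. -/
theorem exists_step (h : 𝒜.Extends ℬ) (hne : 𝒜 ≠ ℬ) :
    ∃ 𝒞 : FreeFactorSystem Γ, 𝒜.Extends 𝒞 ∧ 𝒞.Extends ℬ ∧ 𝒞.depth = 𝒜.depth - 1 := by
  classical
  obtain ⟨k, n, A₀, Z₀, hf₀⟩ := 𝒜.exists_fineRealization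
  obtain ⟨L, B, C, ⟨hB1, hB2, hB3⟩, -⟩ := ℬ.exists_realization
  have hchoice : ∀ i, ∃ (j : Fin L) (g : Γ), ∀ x ∈ A₀ i, g * x * g⁻¹ ∈ B j := by
    intro i
    obtain ⟨b, hb, hab⟩ := h (conjClass (A₀ i)) (hf₀.components_eq ▸ ⟨i, rfl⟩)
    rw [hB1] at hb
    obtain ⟨j, rfl⟩ := hb
    exact ⟨j, contained_conjClass_iff.1 hab⟩
  choose o g hg using hchoice
  obtain ⟨A, β, Z, o', hf, hA, hZ⟩ := hf₀.exists_compatible hB3 (fun i => some (o i)) g hg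
  simp only [Option.elim_some] at hA
  have hfin : Finite β := hf₀.finite_of_finite hf
  have hdepth := hf.depth_eq
  by_cases h1 : ∃ l j, o' l = some j
  · obtain ⟨l, j, hlj⟩ := h1
    have hZj : Z l ≤ B j := by simpa [hlj] using hZ l
    have hp := hf.promote l
    obtain ⟨𝒞, h𝒞⟩ := hp.exists_system
    rw [← h𝒞] at hp
    refine ⟨𝒞, ?_, ?_, ?_⟩
    · intro a ha
      rw [hf.components_eq] at ha
      obtain ⟨i, rfl⟩ := ha
      exact exists_contained_of_mem_range hp.components_eq (some i) le_rfl
    · intro a ha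
      rw [hp.components_eq] at ha
      obtain ⟨_ | i, rfl⟩ := ha
      · exact exists_contained_of_mem_range hB1 j hZj
      · exact exists_contained_of_mem_range hB1 (o i) (hA i)
    · rw [hp.depth_eq, hdepth, Finite.card_option,
        ← Nat.card_congr (Equiv.optionSubtypeNe l), Finite.card_option]
      push_cast
      ring
  by_cases h2 : ∃ i i', i ≠ i' ∧ o i = o i'
  · obtain ⟨i, i', hii, hoi⟩ := h2
    let π : Fin k → {j // j ≠ i'} := fun j => if hj : j = i' then ⟨i, hii⟩ else ⟨j, hj⟩
    have hπ : ∀ j : {j // j ≠ i'}, π j = j := fun j => dif_neg j.2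
    have hπo : ∀ j, o (π j) = o j := by
      intro j
      by_cases hj : j = i'
      · simp only [π, dif_pos hj]
        rw [hj, hoi]
      · simp only [π, dif_neg hj]
    have hp := hf.merge π (fun j => ⟨j, hπ j⟩)
    obtain ⟨𝒞, h𝒞⟩ := hp.exists_system
    rw [← h𝒞] at hp
    refine ⟨𝒞, ?_, ?_, ?_⟩
    · intro a ha
      rw [hf.components_eq] at ha
      obtain ⟨j, rfl⟩ := ha
      exact exists_contained_of_mem_range hp.components_eq (π j)
        (le_iSup (fun j' : {j' // π j' = π j} => A j') ⟨j, rfl⟩)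
    · intro a ha
      rw [hp.components_eq] at ha
      obtain ⟨j, rfl⟩ := ha
      refine exists_contained_of_mem_range hB1 (o j) (iSup_le ?_)
      rintro ⟨j', rfl⟩
      rw [hπo]
      exact hA j'
    · rw [hp.depth_eq, hdepth, ← Nat.card_congr (Equiv.optionSubtypeNe i'), Finite.card_option]
      push_cast
      ring
  -- each component of `ℬ` now contains a single term, and equals it
  exfalso
  apply hne
  have hgen := hB3.le_iSup_of_le hf.isInternalFreeProduct.iSup_eq_top
    (Sum.elim (fun i => some (o i)) o') (by
      rintro (i | l)
      · exact hA i
      · exact hZ l)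
  have hB : ∀ j, ∃ i, o i = j ∧ B j = A i := by
    intro j
    have hex : ∃ i, o i = j := by
      by_contra hno
      apply hB2 j
      rw [eq_bot_iff]
      refine (hgen (some j)).trans (iSup_le ?_)
      rintro ⟨i | l, hs⟩
      · exact absurd ⟨i, Option.some_injective _ hs⟩ hno
      · exact absurd ⟨l, j, hs⟩ h1
    obtain ⟨i, rfl⟩ := hex
    refine ⟨i, rfl, le_antisymm ((hgen (some (o i))).trans (iSup_le ?_)) (hA i)⟩
    rintro ⟨i' | l, hs⟩
    · have : i = i' := by
        by_contra hne
        exact h2 ⟨i, i', hne, (Option.some_injective _ hs).symm⟩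
      subst this
      exact le_rfl
    · exact absurd ⟨l, _, hs⟩ h1
  apply FreeFactorSystem.ext
  rw [hf.components_eq, hB1]
  ext a
  constructor
  · rintro ⟨i, rfl⟩
    obtain ⟨i', hi', hBi⟩ := hB (o i)
    have : i = i' := by
      by_contra hne
      exact h2 ⟨i, i', hne, hi'.symm⟩
    subst this
    exact ⟨o i, by simp only [hBi]⟩
  · rintro ⟨j, rfl⟩
    obtain ⟨i, -, hBi⟩ := hB j
    exact ⟨i, by simp only [hBi]⟩

end FreeFactorSystem

/-! ### Depth and chains of free factor systems -/

namespace IsInternalFreeProduct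

variable {Γ ι : Type*} [Group Γ] {F : ι → Subgroup Γ}

theorem of_eq_top (i : ι) (hi : F i = ⊤) (hne : ∀ j, j ≠ i → F j = ⊥) :
    IsInternalFreeProduct F := by
  have hmem : ∀ x, x ∈ F i := fun x => hi ▸ Subgroup.mem_top x
  refine of_retraction (eq_top_iff.2 (hi ▸ le_iSup F i))
    (MonoidHom.mk' (coprodOf F i) fun x y => coprodOf_mul (hmem x) (hmem y)) fun j x hx => ?_
  by_cases hj : j = i
  · subst hj
    rfl
  · rw [hne j hj, Subgroup.mem_bot] at hx
    subst hx
    rw [map_one, coprodOf_one]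

end IsInternalFreeProduct

/-- The whole group as the cofactor of an empty set of components. -/
theorem isInternalFreeProduct_top_cofactor (Γ : Type*) [Group Γ] :
    IsInternalFreeProduct (fun o : Option (Fin 0) => o.elim (⊤ : Subgroup Γ) Fin.elim0) :=
  IsInternalFreeProduct.of_eq_top none rfl (by
    rintro (_ | i) h
    · exact absurd rfl h
    · exact i.elim0)

section FreelyDecomposable

variable {Γ : Type*} [Group Γ]

theorem FreelyDecomposable.nontrivial (h : FreelyDecomposable Γ) : Nontrivial Γ := by
  obtain ⟨H₁, H₂, hne, -⟩ := h
  obtain ⟨x, -, hx⟩ := (Subgroup.bot_or_exists_ne_one _).resolve_left (hne 0)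
  exact ⟨x, 1, hx⟩

/-- A commutative group is not freely decomposable, since free factors are malnormal. -/
theorem FreelyDecomposable.not_isMulCommutative (h : FreelyDecomposable Γ)
    (hcomm : ∀ a b : Γ, a * b = b * a) : False := by
  obtain ⟨H₁, H₂, hne, h⟩ := h
  obtain ⟨a, ha, ha1⟩ := (Subgroup.bot_or_exists_ne_one _).resolve_left (hne 0)
  obtain ⟨b, hb, hb1⟩ := (Subgroup.bot_or_exists_ne_one _).resolve_left (hne 1)
  have h1 : b * a * b⁻¹ ∈ (![H₁, H₂] : Fin 2 → Subgroup Γ) 0 := by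
    rwa [hcomm b a, mul_inv_cancel_right]
  have hb0 := (h.malnormal ha ha1 h1).2
  have h2 := (h.malnormal (j := 1) (g := 1) hb0 hb1 (by simpa using hb)).1
  exact absurd h2 (by decide)

/-- A basis with at least two elements splits into two nonempty parts, and a nonempty basis with at
most one element is a singleton. -/
theorem freelyDecomposable_or_isInfiniteCyclic [Nontrivial Γ] {X : Type*}
    (e : Γ ≃* FreeGroup X) : FreelyDecomposable Γ ∨ IsInfiniteCyclic Γ := by
  classical
  rcases subsingleton_or_nontrivial X with hX | hX
  · right
    rcases isEmpty_or_nonempty X with hX' | ⟨⟨x⟩⟩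
    · obtain ⟨a, b, hab⟩ := exists_pair_ne Γ
      exact absurd (e.injective (Subsingleton.elim (e a) (e b))) hab
    · have : Unique X := ⟨⟨x⟩, fun y => Subsingleton.elim _ _⟩
      exact IsInfiniteCyclic.freeGroup.congr e.symm
  · left
    obtain ⟨x, y, hxy⟩ := exists_pair_ne X
    obtain ⟨Z, hZ, hF⟩ := exists_split_cofactor (isInternalFreeProduct_top_cofactor Γ)
      (Subgroup.topEquiv.trans e)
    let π : Fin 0 ⊕ X → Fin 2 := fun s => if s = Sum.inr x then 0 else 1
    let M : Fin 2 → Subgroup Γ := fun k => ⨆ s : {s // π s = k}, Sum.elim Fin.elim0 Z s.1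
    have hM : IsInternalFreeProduct M := hF.merge π
    have hne : ∀ w, M (π (Sum.inr w)) ≠ ⊥ := fun w hbot =>
      (hZ w).ne_bot (eq_bot_iff.2 (le_trans (le_iSup (fun s : {s // π s = π (Sum.inr w)} =>
        (Sum.elim Fin.elim0 Z s.1 : Subgroup Γ)) ⟨Sum.inr w, rfl⟩) hbot.le))
    have hx : π (Sum.inr x) = 0 := if_pos rfl
    have hy : π (Sum.inr y) = 1 := if_neg (by simpa using hxy.symm)
    have hM2 : ![M 0, M 1] = M := by
      funext i
      fin_cases i <;> rfl
    refine ⟨M 0, M 1, ?_⟩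
    rw [hM2]
    refine ⟨fun i => ?_, hM⟩
    fin_cases i
    · exact fun h => hne x (hx.symm ▸ h)
    · exact fun h => hne y (hy.symm ▸ h)

end FreelyDecomposable

section Append

variable {Γ : Type*} [Group Γ] {k n : ℕ} {A : Fin k → Subgroup Γ} {Z : Fin n → Subgroup Γ}
  {S : Set (SubgroupConjClass Γ)}

theorem append_comp_finSumFinEquiv : Fin.append A Z ∘ finSumFinEquiv = Sum.elim A Z := by
  funext s
  cases s <;> simp

theorem IsFineRealization.isFreeFactorization (h : IsFineRealization S A Z) :
    IsFreeFactorization (Fin.append A Z) := by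
  constructor
  · intro i
    refine Fin.addCases (fun i => ?_) (fun l => ?_) i
    · rw [Fin.append_left]
      exact h.ne_bot i
    · rw [Fin.append_right]
      exact (h.cyclic l).ne_bot
  · convert h.isInternalFreeProduct.reindex finSumFinEquiv.symm finSumFinEquiv.symm.injective
      (fun s hs => absurd (finSumFinEquiv.symm.surjective s) hs) using 1
    funext i
    rw [← append_comp_finSumFinEquiv]
    simp

theorem IsFreeFactorization.isFineRealization (h : IsFreeFactorization (Fin.append A Z))
    (hZ : ∀ l, IsInfiniteCyclic (Z l)) (hS : S = Set.range fun i => conjClass (A i)) :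
    IsFineRealization S A Z where
  components_eq := hS
  ne_bot i := by simpa using h.1 (Fin.castAdd n i)
  cyclic := hZ
  isInternalFreeProduct := by
    rw [← append_comp_finSumFinEquiv]
    exact h.2.reindex finSumFinEquiv finSumFinEquiv.injective
      (fun s hs => absurd (finSumFinEquiv.surjective s) hs)

end Append

namespace FreeFactorSystem

variable {Γ : Type*} [Group Γ] {𝒜 ℬ 𝒞 : FreeFactorSystem Γ}

theorem neg_one_le_depth (𝒜 : FreeFactorSystem Γ) : -1 ≤ 𝒜.depth := by
  unfold depth
  omega

theorem Extends.refl (𝒜 : FreeFactorSystem Γ) : 𝒜.Extends 𝒜 := fun a ha => by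
  obtain ⟨A, rfl⟩ := exists_conjClass_eq a
  exact ⟨_, ha, contained_of_le le_rfl⟩

theorem Extends.trans (h : 𝒜.Extends ℬ) (h' : ℬ.Extends 𝒞) : 𝒜.Extends 𝒞 := by
  intro a ha
  obtain ⟨b, hb, hab⟩ := h a ha
  obtain ⟨c, hc, hbc⟩ := h' b hb
  refine ⟨c, hc, ?_⟩
  obtain ⟨A, rfl⟩ := exists_conjClass_eq a
  obtain ⟨B, rfl⟩ := exists_conjClass_eq b
  obtain ⟨C, rfl⟩ := exists_conjClass_eq c
  obtain ⟨g, hg⟩ := contained_conjClass_iff.1 hab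
  obtain ⟨g', hg'⟩ := contained_conjClass_iff.1 hbc
  refine contained_conjClass_iff.2 ⟨g' * g, fun x hx => ?_⟩
  have := hg' _ (hg x hx)
  rwa [show g' * (g * x * g⁻¹) * g'⁻¹ = g' * g * x * (g' * g)⁻¹ by group] at this

/-- Depth is strictly decreasing: repeated steps of depth one towards `ℬ` have to stop, since depth
is bounded below, and they can only stop at `ℬ`. -/
theorem Extends.depth_lt (h : 𝒜.Extends ℬ) (hne : 𝒜 ≠ ℬ) : ℬ.depth < 𝒜.depth := by
  induction hn : (𝒜.depth + 1).toNat using Nat.strong_induction_on generalizing 𝒜 with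
  | _ n ih =>
    obtain ⟨𝒞, -, h2, h3⟩ := exists_step h hne
    by_cases hc : 𝒞 = ℬ
    · subst hc
      omega
    · have := 𝒞.neg_one_le_depth
      have := ih _ (by omega) h2 hc rfl
      omega

/-- Every intermediate depth is attained between a system and an extension of it. -/
theorem Extends.exists_between (h : 𝒜.Extends ℬ) {v : ℤ} (h1 : ℬ.depth ≤ v)
    (h2 : v ≤ 𝒜.depth) : ∃ 𝒞 : FreeFactorSystem Γ, 𝒜.Extends 𝒞 ∧ 𝒞.Extends ℬ ∧ 𝒞.depth = v := by
  induction hn : (𝒜.depth - v).toNat generalizing 𝒜 with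
  | zero => exact ⟨𝒜, Extends.refl 𝒜, h, by omega⟩
  | succ n ih =>
    have hne : 𝒜 ≠ ℬ := by
      rintro rfl
      omega
    obtain ⟨𝒟, hd1, hd2, hd3⟩ := exists_step h hne
    obtain ⟨𝒞, hc1, hc2, hc3⟩ := ih hd2 (by omega) (by omega)
    exact ⟨𝒞, hd1.trans hc1, hc2, hc3⟩

theorem fineRealization_of_components_eq [Nontrivial Γ] {S : Set (SubgroupConjClass Γ)}
    (hS : S = {conjClass ⊤}) :
    IsFineRealization S (fun _ : Fin 1 => (⊤ : Subgroup Γ)) (Fin.elim0 : Fin 0 → Subgroup Γ) where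
  components_eq := by rw [hS, Set.range_const]
  ne_bot _ := top_ne_bot
  cyclic l := l.elim0
  isInternalFreeProduct := IsInternalFreeProduct.of_eq_top (Sum.inl 0) rfl (by
    rintro (j | j) hj
    · exact absurd (congrArg Sum.inl (Subsingleton.elim j 0)) hj
    · exact j.elim0)

/-- The system `{[Γ]}`, of depth `0`, is the greatest free factor system. -/
theorem exists_improper [Nontrivial Γ] : ∃ 𝒯 : FreeFactorSystem Γ, 𝒯.components = {conjClass ⊤} :=
  (fineRealization_of_components_eq rfl).exists_system

theorem depth_of_components_eq [Nontrivial Γ] (h : 𝒜.components = {conjClass ⊤}) : 𝒜.depth = 0 := by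
  rw [(fineRealization_of_components_eq h).depth_eq]
  simp

theorem extends_of_components_eq {𝒯 : FreeFactorSystem Γ} (h : 𝒯.components = {conjClass ⊤}) :
    𝒜.Extends 𝒯 := by
  intro a _
  obtain ⟨A, rfl⟩ := exists_conjClass_eq a
  exact ⟨conjClass ⊤, by rw [h]; rfl, contained_of_le le_top⟩

theorem isProper_iff [Nontrivial Γ] : 𝒜.IsProper ↔ 0 < 𝒜.depth := by
  obtain ⟨𝒯, h𝒯⟩ := exists_improper (Γ := Γ)
  constructor
  · intro h
    rw [← depth_of_components_eq h𝒯]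
    refine (extends_of_components_eq h𝒯).depth_lt ?_
    rintro rfl
    exact h h𝒯
  · intro h h'
    rw [depth_of_components_eq h'] at h
    exact lt_irrefl _ h

/-- The finite sets that span a simplex of the complex relative to `𝒜`, together with the empty
set, from which maximal chains can be started. -/
def IsRelChain (𝒜 : FreeFactorSystem Γ) (s : Finset (FreeFactorSystem Γ)) : Prop :=
  IsChain Extends (s : Set (FreeFactorSystem Γ)) ∧ ∀ ℬ ∈ s, 𝒜.Extends ℬ ∧ 𝒜 ≠ ℬ ∧ ℬ.IsProper

theorem mem_faces {s : Finset (FreeFactorSystem Γ)} :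
    s ∈ 𝒜.relComplex.faces ↔ s.Nonempty ∧ 𝒜.IsRelChain s := Iff.rfl

/-- A chain is ordered by depth. -/
theorem extends_of_isChain {s : Set (FreeFactorSystem Γ)} (hs : IsChain Extends s) (hℬ : ℬ ∈ s)
    (h𝒞 : 𝒞 ∈ s) (h : 𝒞.depth ≤ ℬ.depth) : ℬ.Extends 𝒞 := by
  by_cases hne : ℬ = 𝒞
  · rw [hne]
    exact Extends.refl 𝒞
  · rcases hs hℬ h𝒞 hne with h1 | h1
    · exact h1
    · exact absurd (h1.depth_lt (Ne.symm hne)) (not_lt.2 h)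

theorem IsRelChain.depth_mem [Nontrivial Γ] {s : Finset (FreeFactorSystem Γ)} (hs : 𝒜.IsRelChain s)
    (hℬ : ℬ ∈ s) : ℬ.depth ∈ Finset.Ioo 0 𝒜.depth := by
  obtain ⟨h1, h2, h3⟩ := hs.2 ℬ hℬ
  exact Finset.mem_Ioo.2 ⟨isProper_iff.1 h3, h1.depth_lt h2⟩

theorem IsRelChain.injOn_depth {s : Finset (FreeFactorSystem Γ)} (hs : 𝒜.IsRelChain s) :
    Set.InjOn depth (s : Set (FreeFactorSystem Γ)) := by
  intro ℬ hℬ 𝒞 h𝒞 h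
  by_contra hne
  exact absurd ((extends_of_isChain hs.1 hℬ h𝒞 h.ge).depth_lt hne) (by omega)

theorem IsRelChain.card_le [Nontrivial Γ] {s : Finset (FreeFactorSystem Γ)} (hs : 𝒜.IsRelChain s) :
    s.card ≤ (𝒜.depth - 1).toNat := by
  have := Finset.card_le_card_of_injOn (t := Finset.Ioo 0 𝒜.depth) depth
    (fun ℬ hℬ => hs.depth_mem hℬ) hs.injOn_depth
  simpa using this

/-- A chain that misses some depth between `0` and the depth of `𝒜` can be enlarged by a system of
that depth. -/
theorem IsRelChain.exists_insert [Nontrivial Γ] {s : Finset (FreeFactorSystem Γ)}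
    (hs : 𝒜.IsRelChain s) (hcard : s.card < (𝒜.depth - 1).toNat) :
    ∃ t, s ⊆ t ∧ t.card = s.card + 1 ∧ 𝒜.IsRelChain t := by
  classical
  obtain ⟨v, hv, hvs⟩ : ∃ v ∈ Finset.Ioo 0 𝒜.depth, v ∉ s.image depth := by
    by_contra! hno
    have := (Finset.card_le_card (show Finset.Ioo 0 𝒜.depth ⊆ s.image depth from hno)).trans
      Finset.card_image_le
    simp only [Int.card_Ioo, sub_zero] at this
    omega
  rw [Finset.mem_Ioo] at hv
  obtain ⟨𝒯, h𝒯⟩ := exists_improper (Γ := Γ)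
  have hd𝒯 := depth_of_components_eq h𝒯
  let s' : Finset (FreeFactorSystem Γ) := insert 𝒜 (insert 𝒯 s)
  have hs' : IsChain Extends (s' : Set (FreeFactorSystem Γ)) := by
    simp only [s', Finset.coe_insert]
    refine (hs.1.insert fun ℬ _ _ => Or.inr (extends_of_components_eq h𝒯)).insert
      fun ℬ hℬ _ => Or.inl ?_
    rcases hℬ with rfl | hℬ
    · exact extends_of_components_eq h𝒯
    · exact (hs.2 ℬ hℬ).1
  -- the neighbours in the chain of a system of the missing depth
  obtain ⟨𝒱, h𝒱, hmin⟩ := Finset.exists_min_image (s'.filter fun ℬ => v < ℬ.depth) depth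
    ⟨𝒜, by simp [s', hv.2]⟩
  obtain ⟨𝒲, h𝒲, hmax⟩ := Finset.exists_max_image (s'.filter fun ℬ => ℬ.depth < v) depth
    ⟨𝒯, by simp [s', hd𝒯, hv.1]⟩
  rw [Finset.mem_filter] at h𝒱 h𝒲
  have h𝒱𝒲 : 𝒱.Extends 𝒲 := extends_of_isChain hs' h𝒱.1 h𝒲.1 (by omega)
  obtain ⟨𝒞, hc1, hc2, hc3⟩ := h𝒱𝒲.exists_between h𝒲.2.le h𝒱.2.le
  have hcs : 𝒞 ∉ s := fun h => hvs (Finset.mem_image.2 ⟨𝒞, h, hc3⟩)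
  have hsub : s ⊆ s' := fun ℬ hℬ => Finset.mem_insert_of_mem (Finset.mem_insert_of_mem hℬ)
  refine ⟨insert 𝒞 s, Finset.subset_insert _ _, Finset.card_insert_of_notMem hcs, ?_, ?_⟩
  · rw [Finset.coe_insert]
    refine hs.1.insert fun ℬ hℬ _ => ?_
    have hne : ℬ.depth ≠ v := fun h => hvs (Finset.mem_image.2 ⟨ℬ, hℬ, h⟩)
    rcases lt_or_gt_of_ne hne with hlt | hgt
    · left
      exact hc2.trans (extends_of_isChain hs' h𝒲.1 (hsub hℬ)
        (hmax ℬ (Finset.mem_filter.2 ⟨hsub hℬ, hlt⟩)))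
    · right
      exact (extends_of_isChain hs' (hsub hℬ) h𝒱.1
        (hmin ℬ (Finset.mem_filter.2 ⟨hsub hℬ, hgt⟩))).trans hc1
  · intro ℬ hℬ
    rcases Finset.mem_insert.1 hℬ with rfl | hℬ
    · refine ⟨(extends_of_isChain hs' (Finset.mem_insert_self _ _) h𝒱.1 ?_).trans hc1, ?_, ?_⟩
      · exact hmin 𝒜 (Finset.mem_filter.2 ⟨Finset.mem_insert_self _ _, hv.2⟩)
      · rintro rfl
        omega
      · exact isProper_iff.2 (by omega)
    · exact hs.2 ℬ hℬ

theorem IsRelChain.exists_maximal [Nontrivial Γ] {s : Finset (FreeFactorSystem Γ)}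
    (hs : 𝒜.IsRelChain s) : ∃ t, s ⊆ t ∧ t.card = (𝒜.depth - 1).toNat ∧ 𝒜.IsRelChain t := by
  induction hn : (𝒜.depth - 1).toNat - s.card generalizing s with
  | zero => exact ⟨s, subset_rfl, by have := hs.card_le; omega, hs⟩
  | succ n ih =>
    obtain ⟨t, hst, ht, hts⟩ := hs.exists_insert (by omega)
    obtain ⟨t', htt, h'⟩ := ih hts (by omega)
    exact ⟨t', hst.trans htt, h'⟩

theorem faces_eq_empty_iff [Nontrivial Γ] : 𝒜.relComplex.faces = ∅ ↔ 𝒜.depth ≤ 1 := by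
  constructor
  · intro h
    by_contra! hd
    have h0 : 𝒜.IsRelChain ∅ := ⟨by simp, by simp⟩
    obtain ⟨t, -, ht, hts⟩ := h0.exists_maximal
    have : t ∈ 𝒜.relComplex.faces := mem_faces.2 ⟨Finset.card_pos.1 (by omega), hts⟩
    rw [h] at this
    exact this
  · intro hd
    rw [Set.eq_empty_iff_forall_notMem]
    intro s hs
    obtain ⟨h1, h2⟩ := mem_faces.1 hs
    have := h2.card_le
    have := Finset.card_pos.2 h1
    omega

theorem simplicialDim_of_le_one [Nontrivial Γ] (h : 𝒜.depth ≤ 1) :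
    simplicialDim 𝒜.relComplex = ⊥ := by
  have : IsEmpty 𝒜.relComplex.faces := Set.isEmpty_coe_sort.2 (faces_eq_empty_iff.2 h)
  exact iSup_of_empty _

theorem simplicialDim_of_two_le [Nontrivial Γ] {d : ℕ} (h : (d : ℤ) = 𝒜.depth - 2) :
    simplicialDim 𝒜.relComplex = ((d : ℕ∞) : WithBot ℕ∞) := by
  have hd : (𝒜.depth - 1).toNat = d + 1 := by omega
  refine le_antisymm (iSup_le fun s => ?_) ?_
  · have := (mem_faces.1 s.2).2.card_le
    have : s.1.card - 1 ≤ d := by omega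
    exact_mod_cast this
  · have h0 : 𝒜.IsRelChain ∅ := ⟨by simp, by simp⟩
    obtain ⟨t, -, ht, hts⟩ := h0.exists_maximal
    have hmem : t ∈ 𝒜.relComplex.faces := mem_faces.2 ⟨Finset.card_pos.1 (by omega), hts⟩
    have := le_iSup (fun s : 𝒜.relComplex.faces =>
      (((s.1.card - 1 : ℕ) : ℕ∞) : WithBot ℕ∞)) ⟨t, hmem⟩
    have hc : t.card - 1 = d := by omega
    simp only [hc] at this
    exact this

theorem simplicialDim_eq_iff [Nontrivial Γ] (n : ℕ) :
    simplicialDim 𝒜.relComplex = ((n : ℕ∞) : WithBot ℕ∞) ↔ 𝒜.depth = n + 2 := by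
  by_cases h : 𝒜.depth ≤ 1
  · rw [simplicialDim_of_le_one h]
    constructor
    · intro h'
      exact absurd h'.symm (WithBot.coe_ne_bot)
    · intro h'
      omega
  · have hd : (((𝒜.depth - 2).toNat : ℕ) : ℤ) = 𝒜.depth - 2 := by omega
    rw [simplicialDim_of_two_le hd, WithBot.coe_inj, Nat.cast_inj]
    omega

end FreeFactorSystem

/-! ### Systems of small depth -/

section Classification

variable {Γ : Type*} [Group Γ] {𝒜 : FreeFactorSystem Γ}

theorem range_fin_one {T : Type*} (f : Fin 1 → T) : Set.range f = {f 0} := by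
  ext x
  simp [Fin.exists_fin_succ, eq_comm]

theorem range_fin_two {T : Type*} (f : Fin 2 → T) : Set.range f = {f 0, f 1} := by
  ext x
  simp [Fin.exists_fin_succ, eq_comm]

theorem range_fin_three {T : Type*} (f : Fin 3 → T) : Set.range f = {f 0, f 1, f 2} := by
  ext x
  simp [Fin.exists_fin_succ, eq_comm]

theorem range_fin_four {T : Type*} (f : Fin 4 → T) : Set.range f = {f 0, f 1, f 2, f 3} := by
  ext x
  simp [Fin.exists_fin_succ, eq_comm]

/-- The numbers of components and of cyclic factors of a fine realization determine the depth. -/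
theorem IsFineRealization.depth_eq_fin {k n : ℕ} {A : Fin k → Subgroup Γ} {Z : Fin n → Subgroup Γ}
    (h : IsFineRealization 𝒜.components A Z) : 𝒜.depth = 2 * (n : ℤ) + k - 1 := by
  simpa using h.depth_eq

theorem depth_eq_of_isFreeFactorization {k n : ℕ} {A : Fin k → Subgroup Γ}
    {Z : Fin n → Subgroup Γ} {F : Fin (k + n) → Subgroup Γ} (h : IsFreeFactorization F)
    (hF : F = Fin.append A Z) (hZ : ∀ l, IsInfiniteCyclic (Z l))
    (hS : 𝒜.components = Set.range fun i => conjClass (A i)) : 𝒜.depth = 2 * (n : ℤ) + k - 1 := by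
  subst hF
  exact (h.isFineRealization hZ hS).depth_eq_fin

theorem IsFineRealization.exists_isFreeFactorization {k n : ℕ} {A : Fin k → Subgroup Γ}
    {Z : Fin n → Subgroup Γ} {S : Set (SubgroupConjClass Γ)} (h : IsFineRealization S A Z)
    {F : Fin (k + n) → Subgroup Γ} (hF : F = Fin.append A Z) : IsFreeFactorization F :=
  hF ▸ h.isFreeFactorization

theorem IsFineRealization.sup_eq_top {k n : ℕ} {A : Fin k → Subgroup Γ} {Z : Fin n → Subgroup Γ}
    {S : Set (SubgroupConjClass Γ)} (h : IsFineRealization S A Z) :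
    (⨆ i, A i) ⊔ ⨆ l, Z l = ⊤ := by
  rw [← h.isInternalFreeProduct.iSup_eq_top, iSup_sum]
  rfl

theorem depth_le_one_iff (hΓ : FreelyDecomposable Γ) : 𝒜.depth ≤ 1 ↔
    𝒜.components = {conjClass ⊤} ∨
      ∃ A₁ A₂ : Subgroup Γ, 𝒜.components = {conjClass A₁, conjClass A₂} ∧
        IsFreeFactorization ![A₁, A₂] := by
  have := hΓ.nontrivial
  constructor
  · intro hd
    obtain ⟨k, n, A, Z, h⟩ := 𝒜.exists_fineRealization
    have hd' := h.depth_eq_fin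
    have htop := h.sup_eq_top
    obtain ⟨rfl, rfl⟩ | ⟨rfl, rfl⟩ | ⟨rfl, rfl⟩ | ⟨rfl, rfl⟩ :
        (k = 0 ∧ n = 0) ∨ (k = 1 ∧ n = 0) ∨ (k = 0 ∧ n = 1) ∨ (k = 2 ∧ n = 0) := by omega
    · simp only [iSup_of_empty, sup_bot_eq] at htop
      exact absurd htop bot_ne_top
    · left
      rw [h.components_eq, range_fin_one]
      simp only [iSup_of_empty, sup_bot_eq, ciSup_unique] at htop
      rw [← htop]
      rfl
    · exfalso
      simp only [iSup_of_empty, bot_sup_eq, ciSup_unique] at htop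
      have hc := (h.cyclic default).1
      rw [htop] at hc
      have hcomm := hc.isMulCommutative
      exact hΓ.not_isMulCommutative fun a b => congrArg Subtype.val
        (hcomm.is_comm.comm (⟨a, trivial⟩ : (⊤ : Subgroup Γ)) ⟨b, trivial⟩)
    · right
      refine ⟨A 0, A 1, by rw [h.components_eq, range_fin_two], h.exists_isFreeFactorization ?_⟩
      funext i
      fin_cases i <;> rfl
  · rintro (h | ⟨A₁, A₂, h1, h2⟩)
    · rw [FreeFactorSystem.depth_of_components_eq h]
      exact zero_le_one
    · have := depth_eq_of_isFreeFactorization (𝒜 := 𝒜) (k := 2) (n := 0) (A := ![A₁, A₂])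
        (Z := Fin.elim0) h2 (by funext i; fin_cases i <;> rfl) (fun l => l.elim0)
        (by rw [h1, range_fin_two]; rfl)
      rw [this]
      norm_num

theorem depth_eq_two_iff : 𝒜.depth = 2 ↔
    (∃ A Z : Subgroup Γ, 𝒜.components = {conjClass A} ∧
      IsFreeFactorization ![A, Z] ∧ IsInfiniteCyclic Z) ∨
    ∃ A₁ A₂ A₃ : Subgroup Γ, 𝒜.components = {conjClass A₁, conjClass A₂, conjClass A₃} ∧
      IsFreeFactorization ![A₁, A₂, A₃] := by
  constructor
  · intro hd
    obtain ⟨k, n, A, Z, h⟩ := 𝒜.exists_fineRealization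
    have hd' := h.depth_eq_fin
    obtain ⟨rfl, rfl⟩ | ⟨rfl, rfl⟩ : (k = 1 ∧ n = 1) ∨ (k = 3 ∧ n = 0) := by omega
    · left
      refine ⟨A 0, Z 0, by rw [h.components_eq, range_fin_one],
        h.exists_isFreeFactorization ?_, h.cyclic 0⟩
      funext i
      fin_cases i <;> rfl
    · right
      refine ⟨A 0, A 1, A 2, by rw [h.components_eq, range_fin_three],
        h.exists_isFreeFactorization ?_⟩
      funext i
      fin_cases i <;> rfl
  · rintro (⟨A, Z, h1, h2, h3⟩ | ⟨A₁, A₂, A₃, h1, h2⟩)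
    · exact depth_eq_of_isFreeFactorization (𝒜 := 𝒜) (k := 1) (n := 1) (A := ![A])
        (Z := ![Z]) h2 (by funext i; fin_cases i <;> rfl)
        (fun l => by fin_cases l; exact h3) (by rw [h1, range_fin_one]; rfl)
    · exact depth_eq_of_isFreeFactorization (𝒜 := 𝒜) (k := 3) (n := 0) (A := ![A₁, A₂, A₃])
        (Z := Fin.elim0) h2 (by funext i; fin_cases i <;> rfl) (fun l => l.elim0)
        (by rw [h1, range_fin_three]; rfl)

theorem depth_eq_three_iff : 𝒜.depth = 3 ↔
    (𝒜.components = ∅ ∧ ∃ Z₁ Z₂ : Subgroup Γ, IsFreeFactorization ![Z₁, Z₂] ∧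
      IsInfiniteCyclic Z₁ ∧ IsInfiniteCyclic Z₂) ∨
    (∃ A₁ A₂ Z : Subgroup Γ, 𝒜.components = {conjClass A₁, conjClass A₂} ∧
      IsFreeFactorization ![A₁, A₂, Z] ∧ IsInfiniteCyclic Z) ∨
    ∃ A₁ A₂ A₃ A₄ : Subgroup Γ,
      𝒜.components = {conjClass A₁, conjClass A₂, conjClass A₃, conjClass A₄} ∧
      IsFreeFactorization ![A₁, A₂, A₃, A₄] := by
  constructor
  · intro hd
    obtain ⟨k, n, A, Z, h⟩ := 𝒜.exists_fineRealization
    have hd' := h.depth_eq_fin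
    obtain ⟨rfl, rfl⟩ | ⟨rfl, rfl⟩ | ⟨rfl, rfl⟩ :
        (k = 0 ∧ n = 2) ∨ (k = 2 ∧ n = 1) ∨ (k = 4 ∧ n = 0) := by omega
    · left
      refine ⟨by rw [h.components_eq, Set.range_eq_empty], Z 0, Z 1,
        h.exists_isFreeFactorization ?_, h.cyclic 0, h.cyclic 1⟩
      funext i
      fin_cases i <;> rfl
    · right; left
      refine ⟨A 0, A 1, Z 0, by rw [h.components_eq, range_fin_two],
        h.exists_isFreeFactorization ?_, h.cyclic 0⟩
      funext i
      fin_cases i <;> rfl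
    · right; right
      refine ⟨A 0, A 1, A 2, A 3, by rw [h.components_eq, range_fin_four],
        h.exists_isFreeFactorization ?_⟩
      funext i
      fin_cases i <;> rfl
  · rintro (⟨h1, Z₁, Z₂, h2, h3, h4⟩ | ⟨A₁, A₂, Z, h1, h2, h3⟩ | ⟨A₁, A₂, A₃, A₄, h1, h2⟩)
    · exact depth_eq_of_isFreeFactorization (𝒜 := 𝒜) (k := 0) (n := 2) (A := Fin.elim0)
        (Z := ![Z₁, Z₂]) h2 (by funext i; fin_cases i <;> rfl)
        (fun l => by fin_cases l; exacts [h3, h4]) (by rw [h1, Set.range_eq_empty])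
    · exact depth_eq_of_isFreeFactorization (𝒜 := 𝒜) (k := 2) (n := 1) (A := ![A₁, A₂])
        (Z := ![Z]) h2 (by funext i; fin_cases i <;> rfl)
        (fun l => by fin_cases l; exact h3) (by rw [h1, range_fin_two]; rfl)
    · exact depth_eq_of_isFreeFactorization (𝒜 := 𝒜) (k := 4) (n := 0) (A := ![A₁, A₂, A₃, A₄])
        (Z := Fin.elim0) h2 (by funext i; fin_cases i <;> rfl) (fun l => l.elim0)
        (by rw [h1, range_fin_four]; rfl)

/-- In a free group of rank two all factors of a Grushko system are free by the Nielsen–Schreier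
theorem, hence freely decomposable or infinite cyclic, so that there are none. -/
theorem free_of_rank_two_iff :
    (𝒜.components = ∅ ∧ ∃ Z₁ Z₂ : Subgroup Γ, IsFreeFactorization ![Z₁, Z₂] ∧
        IsInfiniteCyclic Z₁ ∧ IsInfiniteCyclic Z₂) ↔
      Nonempty (Γ ≃* FreeGroup (Fin 2)) ∧ 𝒜.IsGrushko := by
  constructor
  · rintro ⟨h1, Z₁, Z₂, h2, h3, h4⟩
    have hF : ![Z₁, Z₂] = Fin.append Fin.elim0 ![Z₁, Z₂] := by
      funext i
      fin_cases i <;> rfl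
    have h : IsFineRealization 𝒜.components (Fin.elim0 : Fin 0 → Subgroup Γ) ![Z₁, Z₂] :=
      IsFreeFactorization.isFineRealization (k := 0) (n := 2) (hF ▸ h2)
        (fun l => by fin_cases l; exacts [h3, h4]) (by rw [h1, Set.range_eq_empty])
    obtain ⟨B, hB, ⟨e⟩⟩ := exists_merged_cofactor h.isInternalFreeProduct h.cyclic
    have htop : B = ⊤ := by
      have := hB.iSup_eq_top
      rw [iSup_option] at this
      simpa using this
    refine ⟨⟨(Subgroup.topEquiv.symm.trans (MulEquiv.subgroupCongr htop.symm)).trans e⟩,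
      0, Fin.elim0, B, ⟨h.components_eq, fun i => i.elim0, hB⟩, ⟨2, ⟨e⟩⟩, fun i => i.elim0⟩
  · rintro ⟨⟨e⟩, k, A, B, ⟨h1, h2, -⟩, -, h4⟩
    have hfree : IsFreeGroup Γ := IsFreeGroup.ofMulEquiv e.symm
    have hk : k = 0 := by
      by_contra hk
      let i : Fin k := ⟨0, Nat.pos_of_ne_zero hk⟩
      have : Nontrivial (A i) := (Subgroup.nontrivial_iff_ne_bot _).2 (h2 i)
      rcases freelyDecomposable_or_isInfiniteCyclic (IsFreeGroup.toFreeGroup (A i)) with h | h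
      · exact (h4 i).1 h
      · exact (h4 i).2 h
    subst hk
    have hS : 𝒜.components = ∅ := by rw [h1, Set.range_eq_empty]
    obtain ⟨Z, hZ, hF⟩ := exists_split_cofactor (isInternalFreeProduct_top_cofactor Γ)
      (Subgroup.topEquiv.trans e)
    have hf : IsFineRealization 𝒜.components (Fin.elim0 : Fin 0 → Subgroup Γ) Z :=
      ⟨by rw [hS, Set.range_eq_empty], fun i => i.elim0, hZ, hF⟩
    refine ⟨hS, Z 0, Z 1, hf.exists_isFreeFactorization ?_, hZ 0, hZ 1⟩
    funext i
    fin_cases i <;> rfl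

end Classification

theorem mainTheorem7 {Γ : Type*} [Group Γ] (hΓ : FreelyDecomposable Γ) (𝒜 : FreeFactorSystem Γ) :
    -- dimension formula, and every simplex lies in one of top dimension
    (2 ≤ 𝒜.depth → ∃ d : ℕ, (d : ℤ) = 𝒜.depth - 2 ∧
      simplicialDim 𝒜.relComplex = ((d : ℕ∞) : WithBot ℕ∞) ∧
      ∀ s ∈ 𝒜.relComplex.faces, ∃ t ∈ 𝒜.relComplex.faces, s ⊆ t ∧ t.card = d + 1) ∧
    -- exceptional systems, and one-dimensional complexes
    (𝒜.IsExceptional ↔ 𝒜.relComplex.faces = ∅ ∨ simplicialDim 𝒜.relComplex = 0) ∧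
    (𝒜.depth = 3 ↔ simplicialDim 𝒜.relComplex = 1) ∧
    -- the empty case
    (𝒜.relComplex.faces = ∅ ↔ 𝒜.depth ≤ 1) ∧
    (𝒜.depth ≤ 1 ↔
      𝒜.components = {conjClass ⊤} ∨
      ∃ A₁ A₂ : Subgroup Γ, 𝒜.components = {conjClass A₁, conjClass A₂} ∧
        IsFreeFactorization ![A₁, A₂]) ∧
    -- the zero-dimensional case
    (simplicialDim 𝒜.relComplex = 0 ↔ 𝒜.depth = 2) ∧
    (𝒜.depth = 2 ↔
      (∃ A Z : Subgroup Γ, 𝒜.components = {conjClass A} ∧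
        IsFreeFactorization ![A, Z] ∧ IsInfiniteCyclic Z) ∨
      ∃ A₁ A₂ A₃ : Subgroup Γ, 𝒜.components = {conjClass A₁, conjClass A₂, conjClass A₃} ∧
        IsFreeFactorization ![A₁, A₂, A₃]) ∧
    -- the one-dimensional case
    (𝒜.depth = 3 ↔
      (𝒜.components = ∅ ∧ ∃ Z₁ Z₂ : Subgroup Γ, IsFreeFactorization ![Z₁, Z₂] ∧
        IsInfiniteCyclic Z₁ ∧ IsInfiniteCyclic Z₂) ∨
      (∃ A₁ A₂ Z : Subgroup Γ, 𝒜.components = {conjClass A₁, conjClass A₂} ∧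
        IsFreeFactorization ![A₁, A₂, Z] ∧ IsInfiniteCyclic Z) ∨
      ∃ A₁ A₂ A₃ A₄ : Subgroup Γ,
        𝒜.components = {conjClass A₁, conjClass A₂, conjClass A₃, conjClass A₄} ∧
        IsFreeFactorization ![A₁, A₂, A₃, A₄]) ∧
    -- the first of the one-dimensional cases: `Γ` is free of rank 2, and the complex is absolute
    ((𝒜.components = ∅ ∧ ∃ Z₁ Z₂ : Subgroup Γ, IsFreeFactorization ![Z₁, Z₂] ∧
        IsInfiniteCyclic Z₁ ∧ IsInfiniteCyclic Z₂) ↔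
      Nonempty (Γ ≃* FreeGroup (Fin 2)) ∧ 𝒜.IsGrushko) := by
  have := hΓ.nontrivial
  have hempty := 𝒜.faces_eq_empty_iff
  have hdim0 : simplicialDim 𝒜.relComplex = 0 ↔ 𝒜.depth = 2 := by
    simpa using FreeFactorSystem.simplicialDim_eq_iff (𝒜 := 𝒜) 0
  have hdim1 : simplicialDim 𝒜.relComplex = 1 ↔ 𝒜.depth = 3 := by
    simpa using FreeFactorSystem.simplicialDim_eq_iff (𝒜 := 𝒜) 1
  refine ⟨fun h2 => ?_, ?_, hdim1.symm, hempty, depth_le_one_iff hΓ, hdim0, depth_eq_two_iff,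
    depth_eq_three_iff, free_of_rank_two_iff⟩
  · have hd : (((𝒜.depth - 2).toNat : ℕ) : ℤ) = 𝒜.depth - 2 := by omega
    refine ⟨(𝒜.depth - 2).toNat, hd, FreeFactorSystem.simplicialDim_of_two_le hd, fun s hs => ?_⟩
    obtain ⟨t, hst, ht, hts⟩ := (FreeFactorSystem.mem_faces.1 hs).2.exists_maximal
    exact ⟨t, FreeFactorSystem.mem_faces.2 ⟨Finset.card_pos.1 (by omega), hts⟩, hst, by omega⟩
  · rw [hempty, hdim0, FreeFactorSystem.IsExceptional]
    omega
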